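/- Let $\Gamma$ be a countable discrete group, $(A,\tau_A)$ a separable tracial von Neumann algebra ($\tau_A$ a faithful normal tracial state, $L^2(A)=L^2(A,\tau_A)$ separable), and $\sigma:\Gamma\curvearrowright(A,\tau_A)$ a trace preserving action. On $H=\ell^2(\Gamma)\otimes L^2(A)=\ell^2(\Gamma,L^2(A))$ put $(\pi(a)\xi)(h)=\sigma_h^{-1}(a)\xi(h)$, let $\lambda$ be the left regular representation of $\Gamma$ on $\ell^2(\Gamma)$, let $M=\Gamma\ltimes A$ be the von Neumann algebra generated by $\{\lambda_g\otimes 1: g\in\Gamma\}$ and $\pi(A)$, and let $\mathscr A=B(\ell^2(\Gamma))\,\overline{\otimes}\,A\subset B(H)$ be the von Neumann algebra generated by $M$ and $\ell^\infty(\Gamma)\otimes 1$. Let $X$ be a topological $\Gamma$-boundary, i.e. a compact Hausdorff space (for instance a compact metrizable one) on which $\Gamma$ acts by homeomorphisms such that, for every Borel probability measure $\nu$ on $X$, the weak$^*$ closure of the orbit $\Gamma\nu$ contains every point mass. For $x\in X$ let $P_{\delta_x}:C(X)\to\ell^\infty(\Gamma)$, $P_{\delta_x}(f)(g)=f(gx)$,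 and let $\mathcal B_X^x\subset\mathscr A$ be the C$^*$-algebra generated by $M$ and $P_{\delta_x}(C(X))\otimes 1$. Then: 1. every $M$-bimodular unital completely positive map $\mathcal B_X^x\to\mathscr A$ is completely isometric; 2. for every $y\in X$ there is an $M$-bimodular $*$-isomorphism $\mathcal B_X^x\to\mathcal B_X^y$; 3. if $A$ is amenable (there is a conditional expectation of $B(L^2(A))$ onto $A$), then $\mathcal B_X^x$ is an $M$-boundary, i.e. the inclusion $M\subset\mathcal B_X^x$ is essential: for every C$^*$-inclusion $M\subset\mathcal C$, every $M$-bimodular unital completely positive map $\mathcal B_X^x\to\mathcal C$ is completely isometric. In particular (the case $A=\mathbb C$), writing $L(\Gamma)\subset B(\ell^2(\Gamma))$ for the von Neumann algebra generated by $\{\lambda_g : g\in\Gamma\}$, the C$^*$-algebra $\mathrm C^*(L(\Gamma),P_{\delta_x}(C(X)))\subset B(\ell^2(\Gamma))$ is an $L(\Gamma)$-boundary. -/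

import Mathlib

open scoped ComplexOrder CStarAlgebra

universe u v w z

noncomputable section

namespace NCBoundary

/-! ### C⋆-subalgebras, completely isometric maps, bimodular ucp maps, essential inclusions -/

section CStar

theorem exists_eq_star_mul_self {B : Type u} [CStarAlgebra B] {x : B} (hx : IsSelfAdjoint x)
    (hs : SpectrumRestricts x ContinuousMap.realToNNReal) : ∃ s : B, x = star s * s := by
  let _ : PartialOrder B := CStarAlgebra.spectralOrder B
  have _ : StarOrderedRing B := CStarAlgebra.spectralOrderedRing B
  refine CStarAlgebra.nonneg_iff_eq_star_mul_self.mp ?_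
  rw [nonneg_iff_isSelfAdjoint_and_quasispectrumRestricts,
    quasispectrumRestricts_iff_spectrumRestricts]
  exact ⟨hx, hs⟩

/-- A norm closed unital ⋆-subalgebra, with the order inherited from the ambient C⋆-algebra, is a
star-ordered ring: the positive elements of the subalgebra are those of the form `star s * s`
with `s` in the subalgebra. -/
instance starOrderedRing_of_isClosed {A : Type u} [CStarAlgebra A] [PartialOrder A]
    [StarOrderedRing A] (S : StarSubalgebra ℂ A) [hS : IsClosed (S : Set A)] :
    StarOrderedRing S := by
  refine StarOrderedRing.of_nonneg_iff' (fun {x y} h z => ?_) (fun x => ⟨fun hx => ?_, ?_⟩)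
  · change (z : A) + x ≤ (z : A) + y
    exact add_le_add_right (show (x : A) ≤ y from h) _
  · have hx' : (0 : A) ≤ (x : A) := hx
    have hsa : IsSelfAdjoint x := Subtype.ext (IsSelfAdjoint.of_nonneg hx').star_eq
    refine exists_eq_star_mul_self hsa ?_
    have h2 := (nonneg_iff_isSelfAdjoint_and_quasispectrumRestricts.mp hx').2
    rw [quasispectrumRestricts_iff_spectrumRestricts] at h2
    rw [SpectrumRestricts.nnreal_iff] at h2 ⊢
    have hs : spectrum ℂ x = spectrum ℂ (x : A) := StarSubalgebra.spectrum_eq S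
    intro r hr
    refine h2 r ?_
    rw [← spectrum.algebraMap_mem_iff ℂ] at hr ⊢
    rwa [← hs]
  · rintro ⟨s, rfl⟩
    change (0 : A) ≤ star (s : A) * (s : A)
    exact star_mul_self_nonneg _

variable {M : Type*} {B : Type*} {C : Type*} [Ring M] [StarRing M] [Algebra ℂ M]
  [CStarAlgebra B] [PartialOrder B] [StarOrderedRing B]
  [CStarAlgebra C] [PartialOrder C] [StarOrderedRing C]

/-- A map between C⋆-algebras is completely isometric if all its amplifications to matrix
algebras are isometric for the C⋆-norms. -/
def IsCompletelyIsometric (P : B → C) : Prop :=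
  ∀ (k : ℕ) (T : CStarMatrix (Fin k) (Fin k) B), ‖T.map P‖ = ‖T‖

/-- `P ∈ UCP_M(B, C)`: the completely positive map `P` is unital and `M`-bimodular, where `M` is
mapped into `B` by `ι` and into `C` by `κ`. -/
structure IsBimodularUCP (ι : M →⋆ₐ[ℂ] B) (κ : M →⋆ₐ[ℂ] C) (P : B →CP C) : Prop where
  map_one : P 1 = 1
  bimodular : ∀ (m n : M) (b : B), P (ι m * b * ι n) = κ m * P b * κ n

end CStar

/-- The C⋆-inclusion `ι : M ⊂ B` is essential (equivalently, `B` is an `M`-boundary): for any other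
C⋆-inclusion `κ : M ⊂ C`, every `M`-bimodular ucp map from `B` to `C` is completely isometric. -/
def IsEssential {M : Type u} {B : Type v} [Ring M] [StarRing M] [Algebra ℂ M] [CStarAlgebra B]
    [PartialOrder B] [StarOrderedRing B] (ι : M →⋆ₐ[ℂ] B) : Prop :=
  Function.Injective ι ∧
    ∀ (C : Type w) [CStarAlgebra C] [PartialOrder C] [StarOrderedRing C] (κ : M →⋆ₐ[ℂ] C),
      Function.Injective κ → ∀ P : B →CP C, IsBimodularUCP ι κ P → IsCompletelyIsometric P

/-! ### Von Neumann algebras on a Hilbert space -/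

section VN

variable {H : Type u} [NormedAddCommGroup H] [InnerProductSpace ℂ H] [CompleteSpace H]

/-- The von Neumann algebra generated by a set of operators: the double commutant of the set and
its adjoints. -/
def vnGen (S : Set (H →L[ℂ] H)) : VonNeumannAlgebra H where
  toStarSubalgebra := StarSubalgebra.centralizer ℂ (StarSubalgebra.centralizer ℂ S : Set _)
  centralizer_centralizer' := by
    change Set.centralizer (Set.centralizer
      ((StarSubalgebra.centralizer ℂ (StarSubalgebra.centralizer ℂ S : Set (H →L[ℂ] H)) :
        StarSubalgebra ℂ (H →L[ℂ] H)) : Set (H →L[ℂ] H))) = _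
    rw [StarSubalgebra.coe_centralizer_centralizer, Set.centralizer_centralizer_centralizer]
    exact (StarSubalgebra.coe_centralizer_centralizer (R := ℂ) S).symm

theorem subset_vnGen (S : Set (H →L[ℂ] H)) : S ⊆ (vnGen S).toStarSubalgebra := by
  intro x hx
  change x ∈ ((StarSubalgebra.centralizer ℂ (StarSubalgebra.centralizer ℂ S : Set (H →L[ℂ] H)) :
        StarSubalgebra ℂ (H →L[ℂ] H)) : Set (H →L[ℂ] H))
  rw [StarSubalgebra.coe_centralizer_centralizer]
  exact Set.subset_centralizer_centralizer (Or.inl hx)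

theorem vnGen_mono {S T : Set (H →L[ℂ] H)} (h : S ⊆ T) :
    (vnGen S).toStarSubalgebra ≤ (vnGen T).toStarSubalgebra :=
  StarSubalgebra.centralizer_le ℂ _ _ (StarSubalgebra.centralizer_le ℂ _ _ h)

instance isClosed_vonNeumannAlgebra (N : VonNeumannAlgebra H) :
    IsClosed (N.toStarSubalgebra : Set (H →L[ℂ] H)) := by
  have h : (N.toStarSubalgebra : Set (H →L[ℂ] H)) = Set.centralizer (Set.centralizer N) := by simp
  rw [h]
  exact Set.isClosed_centralizer _

/-- A von Neumann algebra `N ⊂ B(H)` is amenable if there is a conditional expectation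
`B(H) → N`, that is, an `N`-bimodular ucp map from `B(H)` to `N`. -/
def IsAmenableVN (N : VonNeumannAlgebra H) : Prop :=
  ∃ E : (H →L[ℂ] H) →CP N.toStarSubalgebra,
    IsBimodularUCP N.toStarSubalgebra.subtype (StarAlgHom.id ℂ N.toStarSubalgebra) E

/-- The (unital) C⋆-algebra of operators generated by a set: the norm closure of the unital
⋆-algebra generated by it. -/
def cstarGen (S : Set (H →L[ℂ] H)) : StarSubalgebra ℂ (H →L[ℂ] H) :=
  (StarAlgebra.adjoin ℂ S).topologicalClosure

theorem subset_cstarGen (S : Set (H →L[ℂ] H)) : S ⊆ cstarGen S := fun _ hx =>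
  StarSubalgebra.le_topologicalClosure _ (StarAlgebra.subset_adjoin ℂ S hx)

instance isClosed_cstarGen (S : Set (H →L[ℂ] H)) :
    IsClosed (cstarGen S : Set (H →L[ℂ] H)) :=
  StarSubalgebra.isClosed_topologicalClosure _

end VN

/-! ### Tracial von Neumann algebras -/

/-- `τ` is a faithful normal tracial state on the von Neumann algebra `A`. Normality is
preservation of least upper bounds of directed sets. -/
structure IsNormalFaithfulTrace {A : Type u} [CStarAlgebra A] [PartialOrder A]
    [StarOrderedRing A] (τ : A →ₚ[ℂ] ℂ) : Prop where
  map_one : τ 1 = 1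
  map_mul_comm : ∀ a b : A, τ (a * b) = τ (b * a)
  faithful : ∀ a : A, τ (star a * a) = 0 → a = 0
  normal : ∀ S : Set A, S.Nonempty → DirectedOn (· ≤ ·) S → ∀ a : A, IsLUB S a →
    IsLUB (τ '' S) (τ a)

/-- `A` as a von Neumann algebra on `L²(A, τ)`, the Hilbert space of the GNS construction
of `τ`. -/
def standardVN {A : Type u} [CStarAlgebra A] [PartialOrder A] [StarOrderedRing A]
    (τ : A →ₚ[ℂ] ℂ) : VonNeumannAlgebra τ.GNS :=
  vnGen (Set.range τ.gnsStarAlgHom)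

/-! ### Operators on `ℓ²(Γ, K) = ℓ²(Γ) ⊗ K` -/

/-- The Hilbert space `ℓ²(Γ, K) = ℓ²(Γ) ⊗ K`. -/
abbrev Ell2 (Γ : Type u) (K : Type v) [NormedAddCommGroup K] : Type (max u v) :=
  lp (fun _ : Γ => K) 2

section Operators

variable {Γ : Type u} [Group Γ] {K : Type v} [NormedAddCommGroup K] [InnerProductSpace ℂ K]

theorem summable_weighted (e : Γ ≃ Γ) (T : Γ → K →L[ℂ] K) (c : ℝ) (hT : ∀ h, ‖T h‖ ≤ c)
    (ξ : Ell2 Γ K) :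
    Memℓp (fun h => T h (ξ (e h))) 2 ∧
      ∑' h, ‖T h (ξ (e h))‖ ^ (2 : ℝ) ≤ (c * ‖ξ‖) ^ (2 : ℝ) := by
  have hc : 0 ≤ c := (norm_nonneg _).trans (hT 1)
  have h2 : (0 : ℝ) < (2 : ENNReal).toReal := by norm_num
  have hs : Summable fun h => ‖ξ h‖ ^ (2 : ℝ) := by simpa using (lp.memℓp ξ).summable h2
  have hs' : Summable fun h => c ^ (2 : ℝ) * ‖ξ (e h)‖ ^ (2 : ℝ) :=
    ((e.summable_iff (f := fun h => ‖ξ h‖ ^ (2 : ℝ))).mpr hs).mul_left _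
  have hle : ∀ h, ‖T h (ξ (e h))‖ ^ (2 : ℝ) ≤ c ^ (2 : ℝ) * ‖ξ (e h)‖ ^ (2 : ℝ) := fun h => by
    rw [← Real.mul_rpow hc (norm_nonneg _)]
    exact Real.rpow_le_rpow (norm_nonneg _) ((T h).le_of_opNorm_le (hT h) _) (by norm_num)
  have hsum := Summable.of_nonneg_of_le (fun h => by positivity) hle hs'
  refine ⟨memℓp_gen (by simpa using hsum), (hsum.tsum_le_tsum hle hs').trans ?_⟩
  rw [tsum_mul_left, e.tsum_eq (fun h => ‖ξ h‖ ^ (2 : ℝ)), Real.mul_rpow hc (norm_nonneg _)]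
  have := lp.norm_rpow_eq_tsum h2 ξ
  simp only [ENNReal.toReal_ofNat] at this
  rw [this]

/-- The bounded operator `ξ ↦ (h ↦ T h (ξ (e h)))` on `ℓ²(Γ, K)`, for a permutation `e` of `Γ` and
a bounded family `T` of operators on `K`. -/
def weightedPerm (e : Γ ≃ Γ) (T : Γ → K →L[ℂ] K) (c : ℝ) (hT : ∀ h, ‖T h‖ ≤ c) :
    Ell2 Γ K →L[ℂ] Ell2 Γ K :=
  LinearMap.mkContinuous
    { toFun := fun ξ => ⟨fun h => T h (ξ (e h)), (summable_weighted e T c hT ξ).1⟩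
      map_add' := fun ξ η => by ext h; simp; rfl
      map_smul' := fun a ξ => by ext h; simp } c fun ξ => by
    refine lp.norm_le_of_tsum_le (by norm_num)
      (mul_nonneg ((norm_nonneg _).trans (hT 1)) (norm_nonneg _)) ?_
    simpa using (summable_weighted e T c hT ξ).2

@[simp]
theorem weightedPerm_apply (e : Γ ≃ Γ) (T : Γ → K →L[ℂ] K) (c : ℝ) (hT : ∀ h, ‖T h‖ ≤ c)
    (ξ : Ell2 Γ K) (h : Γ) : weightedPerm e T c hT ξ h = T h (ξ (e h)) := rfl

/-- `λ_g ⊗ 1`: the left translation `(λ_g ξ)(h) = ξ(g⁻¹ h)`. -/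
def leftTranslation (K : Type v) [NormedAddCommGroup K] [InnerProductSpace ℂ K] (g : Γ) :
    Ell2 Γ K →L[ℂ] Ell2 Γ K :=
  weightedPerm (Equiv.mulLeft g⁻¹) (fun _ => ContinuousLinearMap.id ℂ K) 1
    (fun _ => ContinuousLinearMap.norm_id_le)

/-- `f ⊗ 1` for a bounded function `f` on `Γ`: multiplication by `f`, `(f ξ)(h) = f(h) ξ(h)`. -/
def mulOp (K : Type v) [NormedAddCommGroup K] [InnerProductSpace ℂ K]
    (f : lp (fun _ : Γ => ℂ) ⊤) : Ell2 Γ K →L[ℂ] Ell2 Γ K :=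
  weightedPerm (Equiv.refl Γ) (fun h => f h • ContinuousLinearMap.id ℂ K) ‖f‖ fun h => by
    rw [norm_smul]
    calc ‖f h‖ * ‖ContinuousLinearMap.id ℂ K‖ ≤ ‖f h‖ * 1 :=
          mul_le_mul_of_nonneg_left ContinuousLinearMap.norm_id_le (norm_nonneg _)
      _ ≤ ‖f‖ := by rw [mul_one]; exact lp.norm_apply_le_norm (by simp) f h

/-- The representation `(π(a) ξ)(h) = σ_h⁻¹(a) ξ(h)` of `A` on `ℓ²(Γ, L²(A, τ))`. -/
def crossedRep {A : Type v} [CStarAlgebra A] [PartialOrder A] [StarOrderedRing A]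
    (τ : A →ₚ[ℂ] ℂ) (σ : Γ →* (A ≃⋆ₐ[ℂ] A)) (a : A) : Ell2 Γ τ.GNS →L[ℂ] Ell2 Γ τ.GNS :=
  weightedPerm (Equiv.refl Γ) (fun h => τ.gnsStarAlgHom ((σ h)⁻¹ a)) ‖a‖ fun h =>
    (NonUnitalStarAlgHom.norm_apply_le τ.gnsStarAlgHom _).trans
      (NonUnitalStarAlgHom.norm_apply_le ((σ h)⁻¹ : A ≃⋆ₐ[ℂ] A) a)

end Operators

/-! ### Topological boundaries and the Poisson transform -/

section Boundary

variable (Γ : Type u) [Group Γ] (X : Type v) [TopologicalSpace X] [MulAction Γ X]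

/-- `X` is a `Γ`-boundary: for every Borel probability measure `ν` on `X`, the weak⋆ closure of the
orbit `Γν` contains all point masses. -/
def IsTopologicalBoundary [MeasurableSpace X] [BorelSpace X] [ContinuousConstSMul Γ X] : Prop :=
  ∀ (ν : MeasureTheory.ProbabilityMeasure X) (x : X),
    MeasureTheory.diracProba x ∈ closure (Set.range fun g : Γ =>
      ν.map (f := fun y : X => g • y) (continuous_const_smul g).measurable.aemeasurable)

variable {X}

/-- The Poisson transform `P_{δ_x} f = (g ↦ f(gx)) ∈ ℓ^∞(Γ)` of `f ∈ C(X)`. -/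
def poissonDirac [CompactSpace X] (x : X) (f : C(X, ℂ)) : lp (fun _ : Γ => ℂ) ⊤ :=
  ⟨fun g => f (g • x), memℓp_infty ⟨‖f‖, by
    rintro _ ⟨g, rfl⟩
    exact f.norm_coe_le_norm _⟩⟩

end Boundary

/-! ### The crossed product `M = Γ ⋉ A`, the algebra `B(ℓ²Γ) ⊗ A`, and `B_X` -/

section CrossedProduct

variable {Γ : Type u} [Group Γ] {A : Type v} [CStarAlgebra A] [PartialOrder A]
  [StarOrderedRing A] (τ : A →ₚ[ℂ] ℂ) (σ : Γ →* (A ≃⋆ₐ[ℂ] A))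

/-- Generators of the crossed product: `λ_g ⊗ 1` and `π(a)`. -/
def crossedGenerators : Set (Ell2 Γ τ.GNS →L[ℂ] Ell2 Γ τ.GNS) :=
  Set.range (leftTranslation (Γ := Γ) τ.GNS) ∪ Set.range (crossedRep τ σ)

/-- The crossed product von Neumann algebra `M = Γ ⋉ A` on `ℓ²(Γ) ⊗ L²(A, τ)`. -/
def crossedProduct : VonNeumannAlgebra (Ell2 Γ τ.GNS) :=
  vnGen (crossedGenerators τ σ)

/-- The von Neumann algebra `⟨M, ℓ^∞(Γ) ⊗ 1⟩`, which is the tensor product `B(ℓ²Γ) ⊗ A` on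
`ℓ²(Γ) ⊗ L²(A, τ)`. -/
def ambient : VonNeumannAlgebra (Ell2 Γ τ.GNS) :=
  vnGen (crossedGenerators τ σ ∪ Set.range (mulOp (Γ := Γ) τ.GNS))

/-- The inclusion of `M = Γ ⋉ A` into `B(ℓ²Γ) ⊗ A`. -/
def crossedToAmbient :
    (crossedProduct τ σ).toStarSubalgebra →⋆ₐ[ℂ] (ambient τ σ).toStarSubalgebra :=
  StarSubalgebra.inclusion (vnGen_mono Set.subset_union_left)

variable {X : Type w} [TopologicalSpace X] [CompactSpace X] [MulAction Γ X]

/-- The C⋆-algebra `B_X^x` generated by `M = Γ ⋉ A` and `P_{δ_x}(C(X)) ⊗ 1`. -/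
def boundaryAlg (x : X) : StarSubalgebra ℂ (Ell2 Γ τ.GNS →L[ℂ] Ell2 Γ τ.GNS) :=
  cstarGen ((crossedProduct τ σ).toStarSubalgebra ∪
    Set.range fun f : C(X, ℂ) => mulOp τ.GNS (poissonDirac Γ x f))

instance isClosed_boundaryAlg (x : X) :
    IsClosed (boundaryAlg τ σ x : Set (Ell2 Γ τ.GNS →L[ℂ] Ell2 Γ τ.GNS)) :=
  isClosed_cstarGen _

/-- The inclusion of `M = Γ ⋉ A` into `B_X^x`. -/
def crossedToBoundary (x : X) :
    (crossedProduct τ σ).toStarSubalgebra →⋆ₐ[ℂ] boundaryAlg τ σ x :=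
  StarSubalgebra.inclusion (Set.subset_union_left.trans (subset_cstarGen _))

end CrossedProduct

/-! ### The case `A = ℂ`: the group von Neumann algebra on `ℓ²(Γ)` -/

section GroupVN

variable (Γ : Type u) [Group Γ]

/-- The group von Neumann algebra `L(Γ)` on `ℓ²(Γ)`. -/
def groupVN : VonNeumannAlgebra (Ell2 Γ ℂ) :=
  vnGen (Set.range (leftTranslation (Γ := Γ) ℂ))

variable {X : Type w} [TopologicalSpace X] [CompactSpace X] [MulAction Γ X]

/-- The C⋆-algebra `C⋆(L(Γ), C(X)) ⊂ B(ℓ²(Γ))`, where `C(X)` acts through `P_{δ_x}`. -/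
def groupBoundaryAlg (x : X) : StarSubalgebra ℂ (Ell2 Γ ℂ →L[ℂ] Ell2 Γ ℂ) :=
  cstarGen ((groupVN Γ).toStarSubalgebra ∪
    Set.range fun f : C(X, ℂ) => mulOp ℂ (poissonDirac Γ x f))

instance isClosed_groupBoundaryAlg (x : X) :
    IsClosed (groupBoundaryAlg Γ x : Set (Ell2 Γ ℂ →L[ℂ] Ell2 Γ ℂ)) :=
  isClosed_cstarGen _

/-- The inclusion of `L(Γ)` into `C⋆(L(Γ), C(X))`. -/
def groupToBoundary (x : X) : (groupVN Γ).toStarSubalgebra →⋆ₐ[ℂ] groupBoundaryAlg Γ x :=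
  StarSubalgebra.inclusion (Set.subset_union_left.trans (subset_cstarGen _))

end GroupVN

end NCBoundary

end

/-!
All four claims rest on one rigidity property of states. Let `ξ = δ_e ⊗ 1`, a vector that is cyclic
for `M`. The vector state of `ξ` on `M` is invariant under conjugation by the unitaries `λ_g ⊗ 1`:
`λ_g ξ` is also the image of `ξ` under a right translation twisted by the implementation of the
action on `L²(A)`, and these translations are isometries in the commutant of `M`
(`isCovariantModel_of_commutant`, `isCovariantModel_crossedProduct`). Moreover `ξ` is an eigenvector
of every `P_{δ_x} f ⊗ 1`, with eigenvalue `f x`, and `λ_g` intertwines `P_{δ_x} f` with `P_{δ_x}` of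
the translate of `f`. These features are recorded in `IsCovariantModel`; the case `A = ℂ` satisfies
them as well.

Let `χ` be a state of `B_X^x` that is the vector state of `ξ` on `M` and evaluation at `y` on
`C(X)`. Since `χ` is multiplicative on `C(X)` and `ξ` is cyclic for elements of `M` that translate
`C(X)`, the map `m ξ ↦ m ξ_χ` into the GNS space of `χ` is an isometry with reducing range, and
compressing to it yields a ⋆-homomorphism that is the identity on `M` and maps `P_{δ_x} f` to
`P_{δ_y} f` (`IsCovariantModel.exists_starAlgHom`). Such states exist in abundance: if `ρ` is any
state of `B_X^x` that is the vector state of `ξ` on `M`, then conjugation of `ρ` by `λ_g` leaves `ρ`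
on `M` unchanged and translates the probability measure that `ρ` gives on `X`; as `X` is a boundary,
a limit along an ultrafilter on `Γ` is evaluation at any prescribed `y`
(`IsCovariantModel.exists_ultrafilter`).

Starting from the vector state of `ξ`, this gives ⋆-homomorphisms between `B_X^x` and `B_X^y` in
both directions, inverse to each other (`IsCovariantModel.exists_starAlgEquiv`). For an
`M`-bimodular ucp map `P` into some `C ⊇ M`, extend the vector state of `ξ` on `M` to a state `ω` of
`C` by Hahn–Banach and start from `ω ∘ P`, with `y = x`: the ⋆-homomorphism obtained is the
identity, so `⟪c ξ, b d ξ⟫` is the limit of `ω((c λ_g)⋆ P(b) d λ_g)`. For a matrix `T` over `B_X^x`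
the corresponding sums are bounded by `‖P(T)‖` times a product of norms of vectors of the form `c
ξ`, by invariance of the vector state; these vectors are dense, so `‖T‖ ≤ ‖P(T)‖`
(`IsCovariantModel.isEssential`). The converse inequality holds for every ucp map (`norm_map_le`).
-/

noncomputable section

namespace NCBoundary

open scoped InnerProductSpace
open Filter Topology

/-! ### Unital completely positive maps are completely contractive -/

section UnitalPositive

variable {B : Type*} {C : Type*} [CStarAlgebra B] [PartialOrder B] [StarOrderedRing B]
  [CStarAlgebra C] [PartialOrder C] [StarOrderedRing C]

theorem norm_le_of_isSelfAdjoint {a : B} (ha : IsSelfAdjoint a) {r : ℝ} (hr : 0 ≤ r)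
    (h1 : a ≤ algebraMap ℝ B r) (h2 : -algebraMap ℝ B r ≤ a) : ‖a‖ ≤ r := by
  cases subsingleton_or_nontrivial B
  · rw [Subsingleton.elim a 0, norm_zero]
    exact hr
  have h3 : -a ≤ algebraMap ℝ B r := neg_le.mp h2
  rw [le_algebraMap_iff_spectrum_le ha] at h1
  rw [le_algebraMap_iff_spectrum_le ha.neg] at h3
  rcases CStarAlgebra.norm_or_neg_norm_mem_spectrum ha with h | h
  · exact h1 _ h
  · refine h3 _ ?_
    rw [← spectrum.neg_eq]
    simpa using h

theorem norm_apply_le_of_isSelfAdjoint (F : B →ₚ[ℂ] C) (hF : F 1 = 1) {a : B}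
    (ha : IsSelfAdjoint a) : ‖F a‖ ≤ ‖a‖ := by
  have hFa (r : ℝ) : F (algebraMap ℝ _ r) = algebraMap ℝ _ r := by
    rw [Algebra.algebraMap_eq_smul_one, PositiveLinearMap.map_smul_of_tower, hF,
      Algebra.algebraMap_eq_smul_one]
  have h1 := OrderHomClass.mono F ha.le_algebraMap_norm_self
  have h2 := OrderHomClass.mono F ha.neg_algebraMap_norm_le_self
  rw [hFa] at h1
  rw [map_neg, hFa] at h2
  exact norm_le_of_isSelfAdjoint (ha.map F) (norm_nonneg _) h1 h2

theorem exists_norm_sq_sub_star_mul_self (a : B) :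
    ∃ s : B, ((‖a‖ ^ 2 : ℝ) : ℂ) • (1 : B) - star a * a = star s * s := by
  have h := CStarAlgebra.star_mul_le_algebraMap_norm_sq (a := a)
  rw [Algebra.algebraMap_eq_smul_one, ← Complex.coe_smul] at h
  exact CStarAlgebra.nonneg_iff_eq_star_mul_self.mp (sub_nonneg.mpr h)

end UnitalPositive

section Blocks

variable {B : Type*} {n : Type*}

/-- The matrix of twice the size with the given four blocks. -/
def blockMatrix (a b c d : CStarMatrix n n B) : CStarMatrix (n ⊕ n) (n ⊕ n) B :=
  CStarMatrix.ofMatrix (Matrix.fromBlocks a b c d)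

theorem blockMatrix_inl_inl (a b c d : CStarMatrix n n B) (i j : n) :
    blockMatrix a b c d (Sum.inl i) (Sum.inl j) = a i j := rfl

theorem blockMatrix_inl_inr (a b c d : CStarMatrix n n B) (i j : n) :
    blockMatrix a b c d (Sum.inl i) (Sum.inr j) = b i j := rfl

theorem blockMatrix_inr_inl (a b c d : CStarMatrix n n B) (i j : n) :
    blockMatrix a b c d (Sum.inr i) (Sum.inl j) = c i j := rfl

theorem blockMatrix_inr_inr (a b c d : CStarMatrix n n B) (i j : n) :
    blockMatrix a b c d (Sum.inr i) (Sum.inr j) = d i j := rfl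

attribute [local simp] blockMatrix_inl_inl blockMatrix_inl_inr blockMatrix_inr_inl
  blockMatrix_inr_inr

/-- The block-diagonal embedding of pairs of matrices into matrices of twice the size. -/
def blockDiag [CStarAlgebra B] [Fintype n] : CStarMatrix n n B × CStarMatrix n n B →⋆ₙₐ[ℂ]
    CStarMatrix (n ⊕ n) (n ⊕ n) B where
  toFun S := blockMatrix S.1 0 0 S.2
  map_zero' := by ext (i | i) (j | j) <;> rfl
  map_add' S T := by ext (i | i) (j | j) <;> simp
  map_smul' r T := by ext (i | i) (j | j) <;> simp
  map_mul' S T := by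
    ext (i | i) (j | j) <;> simp [CStarMatrix.mul_apply]
  map_star' S := by
    ext (i | i) (j | j) <;> simp [CStarMatrix.star_apply]

theorem blockDiag_apply [CStarAlgebra B] [Fintype n] (S : CStarMatrix n n B × CStarMatrix n n B) :
    blockDiag S = blockMatrix S.1 0 0 S.2 := rfl

/-- The self-adjoint matrix with off-diagonal blocks `T` and `star T`. -/
def offDiag [CStarAlgebra B] (T : CStarMatrix n n B) : CStarMatrix (n ⊕ n) (n ⊕ n) B :=
  blockMatrix 0 T (star T) 0

theorem isSelfAdjoint_offDiag [CStarAlgebra B] (T : CStarMatrix n n B) :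
    IsSelfAdjoint (offDiag T) := by
  ext (i | i) (j | j) <;> simp [offDiag, CStarMatrix.star_apply]

end Blocks

section Matrices

attribute [local simp] blockMatrix_inl_inl blockMatrix_inl_inr blockMatrix_inr_inl
  blockMatrix_inr_inr

variable {B : Type*} {C : Type*} [CStarAlgebra B] [PartialOrder B] [StarOrderedRing B]
  [CStarAlgebra C] [PartialOrder C] [StarOrderedRing C] {n : Type*}

theorem norm_offDiag [Fintype n] [DecidableEq n] (T : CStarMatrix n n B) : ‖offDiag T‖ = ‖T‖ := by
  have h : star (offDiag T) * offDiag T = blockDiag (T * star T, star T * T) := by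
    rw [(isSelfAdjoint_offDiag T).star_eq]
    ext (i | i) (j | j) <;> simp [offDiag, blockDiag_apply, CStarMatrix.mul_apply]
  have hinj : Function.Injective (blockDiag (B := B) (n := n)) := by
    intro S T h
    refine Prod.ext ?_ ?_
    · ext i j
      exact congrFun (congrFun h (Sum.inl i)) (Sum.inl j)
    · ext i j
      exact congrFun (congrFun h (Sum.inr i)) (Sum.inr j)
  have h2 : ‖offDiag T‖ * ‖offDiag T‖ = ‖T‖ * ‖T‖ := by
    rw [← CStarRing.norm_star_mul_self, h, NonUnitalStarAlgHom.norm_map _ hinj, Prod.norm_def]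
    simp [CStarRing.norm_star_mul_self, CStarRing.norm_self_mul_star]
  exact (mul_self_inj (norm_nonneg _) (norm_nonneg _)).mp h2

/-- Positive maps are ⋆-preserving, and so are their entrywise amplifications. -/
theorem map_offDiag (P : B →CP C) (T : CStarMatrix n n B) :
    (offDiag T).map P = offDiag (T.map P) := by
  have hstar (x : B) : P (star x) = star (P x) :=
    map_star (PositiveLinearMap.ofClass P : B →ₚ[ℂ] C) x
  ext (i | i) (j | j) <;> simp [offDiag, CStarMatrix.star_apply, hstar]

/-- A unital completely positive map is completely contractive: the amplification of `P` to the
self-adjoint matrix `offDiag T` of norm `‖T‖` is a unital positive map, hence contractive on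
self-adjoint elements. -/
theorem norm_map_le [Fintype n] [DecidableEq n] (P : B →CP C) (hP : P 1 = 1)
    (T : CStarMatrix n n B) : ‖T.map P‖ ≤ ‖T‖ := by
  let F : CStarMatrix (n ⊕ n) (n ⊕ n) B →ₚ[ℂ] CStarMatrix (n ⊕ n) (n ⊕ n) C :=
    PositiveLinearMap.mk₀ (CStarMatrix.mapₗ (P : B →ₗ[ℂ] C)) fun x hx =>
      P.map_cstarMatrix_nonneg x hx
  have hF1 : F 1 = 1 := by
    ext i j
    change P ((1 : CStarMatrix (n ⊕ n) (n ⊕ n) B) i j) = _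
    rw [CStarMatrix.one_apply, CStarMatrix.one_apply]
    split_ifs
    · exact hP
    · exact map_zero P
  have hFT : F (offDiag T) = offDiag (T.map P) := map_offDiag P T
  rw [← norm_offDiag T, ← norm_offDiag (T.map P), ← hFT]
  exact norm_apply_le_of_isSelfAdjoint F hF1 (isSelfAdjoint_offDiag T)

/-- For `Y ∈ Mₙ(C)` and a positive functional `ω`, the sesquilinear form
`(c, d) ↦ ∑ ω(cᵢ⋆ Yᵢⱼ dⱼ)` has norm at most `‖Y‖` for the seminorm `(∑ ω(cᵢ⋆ cᵢ))^(1/2)`. -/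
theorem norm_sum_apply_le [Fintype n] [DecidableEq n] (ω : C →ₚ[ℂ] ℂ)
    (Y : CStarMatrix n n C) (c d : n → C) :
    ‖∑ i, ∑ j, ω (star (c i) * Y i j * d j)‖ ≤
      ‖Y‖ * (√(∑ i, (ω (star (c i) * c i)).re) * √(∑ i, (ω (star (d i) * d i)).re)) := by
  let e : n → C := fun i => ∑ j, Y i j * d j
  -- `‖Y‖² - Y⋆ Y` is a square `S⋆ S`, so it defines a positive form.
  have key : ∑ i, (ω (star (e i) * e i)).re ≤ ‖Y‖ ^ 2 * ∑ i, (ω (star (d i) * d i)).re := by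
    obtain ⟨S, hS⟩ := exists_norm_sq_sub_star_mul_self Y
    have hij (i j : n) : (if i = j then ((‖Y‖ ^ 2 : ℝ) : ℂ) • (1 : C) else 0) -
        ∑ k, star (Y k i) * Y k j = ∑ k, star (S k i) * S k j := by
      have := congrFun (congrFun hS i) j
      rw [CStarMatrix.sub_apply, CStarMatrix.smul_apply, CStarMatrix.one_apply,
        CStarMatrix.mul_apply, CStarMatrix.mul_apply] at this
      simpa only [CStarMatrix.star_apply, smul_ite, smul_zero] using this
    have hsq (Z : CStarMatrix n n C) : ∑ i, ∑ j, star (d i) * (∑ k, star (Z k i) * Z k j) * d j =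
        ∑ k, star (∑ j, Z k j * d j) * (∑ j, Z k j * d j) := by
      simp only [star_sum, Finset.sum_mul_sum]
      simp only [star_mul, Finset.sum_mul, Finset.mul_sum, mul_assoc]
      exact Finset.sum_comm_cycle
    have hsum : ((‖Y‖ ^ 2 : ℝ) : ℂ) • ∑ i, star (d i) * d i - ∑ k, star (e k) * e k =
        ∑ k, star (∑ j, S k j * d j) * (∑ j, S k j * d j) := by
      rw [← hsq S, ← hsq Y]
      simp [← hij, mul_sub, sub_mul, Finset.sum_sub_distrib, Finset.smul_sum]
    have hpos := ω.map_nonneg (Finset.sum_nonneg fun k (_ : k ∈ Finset.univ) =>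
      star_mul_self_nonneg (∑ j, S k j * d j))
    rw [← hsum, map_sub, map_smul, map_sum, map_sum] at hpos
    have := (Complex.nonneg_iff.mp hpos).1
    rw [Complex.sub_re, smul_eq_mul, Complex.re_ofReal_mul, Complex.re_sum, Complex.re_sum] at this
    linarith
  have hn (a : C) : (ω (star a * a)).re = ‖ω.toPreGNS a‖ ^ 2 := by
    have := ω.preGNS_norm_sq (ω.toPreGNS a)
    rw [ω.ofPreGNS_toPreGNS] at this
    rw [← this]
    norm_cast
  have h1 : ∑ i, ∑ j, ω (star (c i) * Y i j * d j) =
      ∑ i, ⟪ω.toPreGNS (c i), ω.toPreGNS (e i)⟫_ℂ := by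
    refine Finset.sum_congr rfl fun i _ => ?_
    rw [ω.preGNS_inner_def, ω.ofPreGNS_toPreGNS, ω.ofPreGNS_toPreGNS, Finset.mul_sum, map_sum]
    simp only [mul_assoc]
  rw [h1]
  simp only [hn] at key ⊢
  calc ‖∑ i, ⟪ω.toPreGNS (c i), ω.toPreGNS (e i)⟫_ℂ‖
      ≤ ∑ i, ‖ω.toPreGNS (c i)‖ * ‖ω.toPreGNS (e i)‖ :=
        (norm_sum_le _ _).trans (Finset.sum_le_sum fun i _ => norm_inner_le_norm _ _)
    _ ≤ √(∑ i, ‖ω.toPreGNS (c i)‖ ^ 2) * √(∑ i, ‖ω.toPreGNS (e i)‖ ^ 2) :=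
        Real.sum_mul_le_sqrt_mul_sqrt _ _ _
    _ ≤ √(∑ i, ‖ω.toPreGNS (c i)‖ ^ 2) * (‖Y‖ * √(∑ i, ‖ω.toPreGNS (d i)‖ ^ 2)) := by
        gcongr
        rw [← Real.sqrt_sq (norm_nonneg Y), ← Real.sqrt_mul (sq_nonneg _)]
        exact Real.sqrt_le_sqrt key
    _ = _ := by ring

end Matrices

/-! ### States: limits, positivity, extension -/

section States

variable {B : Type*} [CStarAlgebra B] [PartialOrder B] [StarOrderedRing B]

/-- A crude bound, enough for the values of all states at `b` to lie in one compact set. -/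
theorem norm_apply_le_four_mul (χ : B →ₚ[ℂ] ℂ) (h1 : χ 1 = 1) (b : B) : ‖χ b‖ ≤ 4 * ‖b‖ := by
  obtain ⟨y, hy0, hy, hb⟩ := CStarAlgebra.exists_sum_four_nonneg b
  conv_lhs => rw [hb]
  simp only [map_sum, map_smul]
  refine (norm_sum_le _ _).trans ?_
  have : ∀ i ∈ (Finset.univ : Finset (Fin 4)), ‖Complex.I ^ (i : ℕ) • χ (y i)‖ ≤ ‖b‖ := by
    intro i _
    rw [norm_smul, norm_pow, Complex.norm_I, one_pow, one_mul]
    refine (χ.norm_apply_le_of_nonneg _ (hy0 i)).trans ?_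
    rw [h1, norm_one, one_mul]
    exact hy i
  refine (Finset.sum_le_sum this).trans ?_
  simp

/-- The pointwise limit of a family of states along an ultrafilter. -/
theorem exists_ultralimit {ι : Type*} (𝒰 : Ultrafilter ι) (χ : ι → B →ₚ[ℂ] ℂ)
    (h1 : ∀ i, χ i 1 = 1) :
    ∃ χ' : B →ₚ[ℂ] ℂ, ∀ b, Tendsto (fun i => χ i b) 𝒰 (𝓝 (χ' b)) := by
  have hlim (b : B) : ∃ l, Tendsto (fun i => χ i b) 𝒰 (𝓝 l) := by
    obtain ⟨l, -, hl⟩ := (isCompact_closedBall (0 : ℂ) (4 * ‖b‖)).ultrafilter_le_nhds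
      (𝒰.map fun i => χ i b) (by
        rw [le_principal_iff]
        refine Ultrafilter.mem_map.mpr (Filter.mem_of_superset univ_mem fun i _ => ?_)
        simpa using norm_apply_le_four_mul (χ i) (h1 i) b)
    exact ⟨l, hl⟩
  choose L hL using hlim
  let L' : B →ₗ[ℂ] ℂ :=
    { toFun := L
      map_add' := fun a b => tendsto_nhds_unique (hL (a + b)) <| by
        simpa using (hL a).add (hL b)
      map_smul' := fun c a => tendsto_nhds_unique (hL (c • a)) <| by
        simpa using (hL a).const_mul c }
  exact ⟨PositiveLinearMap.mk₀ L' fun b hb =>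
    ge_of_tendsto' (hL b) fun i => (χ i).map_nonneg hb, hL⟩

/-- A contractive unital functional is positive. -/
theorem nonneg_of_norm_le_one (ω : B →L[ℂ] ℂ) (hω : ‖ω‖ ≤ 1) (h1 : ω 1 = 1) {a : B}
    (ha : 0 ≤ a) : 0 ≤ ω a := by
  have hle (b : B) : ‖ω b‖ ≤ ‖b‖ :=
    (ω.le_opNorm b).trans (mul_le_of_le_one_left (norm_nonneg _) hω)
  have hsa : IsSelfAdjoint a := .of_nonneg ha
  have hone : ‖(1 : B)‖ ≤ 1 := by
    cases subsingleton_or_nontrivial B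
    · rw [Subsingleton.elim (1 : B) 0, norm_zero]
      exact zero_le_one
    · exact CStarRing.norm_one.le
  -- Contractivity at `a + i t` for all real `t` forces `ω a` to be real.
  have him (t : ℝ) : ((ω a).im + t) ^ 2 ≤ ‖a‖ ^ 2 + t ^ 2 := by
    have h2 : ω (a + ((t : ℂ) * Complex.I) • 1) = ω a + t * Complex.I := by
      rw [map_add, map_smul, h1, smul_eq_mul, mul_one]
    have h3 : ‖a + ((t : ℂ) * Complex.I) • (1 : B)‖ ^ 2 ≤ ‖a‖ ^ 2 + t ^ 2 := by
      have : star (a + ((t : ℂ) * Complex.I) • (1 : B)) * (a + ((t : ℂ) * Complex.I) • 1) =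
          star a * a + ((t ^ 2 : ℝ) : ℂ) • 1 := by
        have hI : Complex.I * Complex.I = -1 := Complex.I_mul_I
        simp only [star_add, star_smul, star_one, hsa.star_eq, add_mul, mul_add, smul_mul_assoc,
          mul_smul_comm, one_mul, mul_one, star_mul', Complex.star_def,
          Complex.conj_ofReal, Complex.conj_I]
        match_scalars
        · simp
        · simp
        · linear_combination (-(t : ℂ) ^ 2) * hI
      rw [sq, ← CStarRing.norm_star_mul_self, this]
      refine (norm_add_le _ _).trans ?_
      rw [CStarRing.norm_star_mul_self, sq ‖a‖, norm_smul, Complex.norm_real, Real.norm_eq_abs,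
        abs_of_nonneg (sq_nonneg t)]
      gcongr
      exact mul_le_of_le_one_right (sq_nonneg t) hone
    have h4 : (ω a).im + t = (ω a + t * Complex.I).im := by simp
    rw [h4, ← sq_abs]
    refine le_trans ?_ h3
    gcongr
    exact (Complex.abs_im_le_norm _).trans (h2 ▸ hle _)
  have him0 : (ω a).im = 0 := by
    by_contra hne
    have := him ((‖a‖ ^ 2) / (ω a).im)
    have h5 : (ω a).im * ((‖a‖ ^ 2) / (ω a).im) = ‖a‖ ^ 2 := by field_simp
    have h6 : 0 < (ω a).im ^ 2 := by positivity
    nlinarith [sq_nonneg ‖a‖]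
  -- `‖ ‖a‖ - a ‖ ≤ ‖a‖` because `0 ≤ a`, so `‖a‖ - ω a ≤ ‖a‖`.
  have hre : 0 ≤ (ω a).re := by
    have h2 : ‖algebraMap ℝ B ‖a‖ - a‖ ≤ ‖a‖ := by
      have h3 := hsa.le_algebraMap_norm_self
      rw [CStarAlgebra.norm_le_iff_le_algebraMap _ (norm_nonneg _) (sub_nonneg.mpr h3)]
      exact sub_le_self _ ha
    have h3 : ω (algebraMap ℝ B ‖a‖ - a) = ‖a‖ - ω a := by
      rw [map_sub, Algebra.algebraMap_eq_smul_one, ← Complex.coe_smul, map_smul, h1, smul_eq_mul,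
        mul_one]
    have h4 := (Complex.re_le_norm _).trans ((hle _).trans h2)
    rw [h3, Complex.sub_re, Complex.ofReal_re] at h4
    linarith
  exact Complex.nonneg_iff.mpr ⟨hre, him0.symm⟩

/-- A contractive unital functional on a C⋆-algebra extends, along any injective unital
⋆-homomorphism, to a state. -/
theorem exists_state_extension {M : Type*} [CStarAlgebra M] (κ : M →⋆ₐ[ℂ] B)
    (hκ : Function.Injective κ) (φ : M →ₗ[ℂ] ℂ) (hφ : ∀ m, ‖φ m‖ ≤ ‖m‖) (h1 : φ 1 = 1) :
    ∃ ω : B →ₚ[ℂ] ℂ, ∀ m, ω (κ m) = φ m := by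
  let e : M ≃ₗ[ℂ] LinearMap.range (κ : M →ₗ[ℂ] B) := LinearEquiv.ofInjective (κ : M →ₗ[ℂ] B) hκ
  have he (m : M) : ((e m : LinearMap.range (κ : M →ₗ[ℂ] B)) : B) = κ m := rfl
  let f : LinearMap.range (κ : M →ₗ[ℂ] B) →L[ℂ] ℂ :=
    (φ ∘ₗ e.symm.toLinearMap).mkContinuous 1 fun z => by
      obtain ⟨m, rfl⟩ := e.surjective z
      rw [one_mul, LinearMap.comp_apply, LinearEquiv.coe_coe, e.symm_apply_apply,
        Submodule.coe_norm, he, NonUnitalStarAlgHom.norm_map κ hκ]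
      exact hφ m
  obtain ⟨ω, hω, hn⟩ := exists_extension_norm_eq _ f
  have hωκ (m : M) : ω (κ m) = φ m := by
    rw [← he, hω]
    change φ (e.symm (e m)) = φ m
    rw [e.symm_apply_apply]
  have hω1 : ω 1 = 1 := by rw [← map_one κ, hωκ, h1]
  refine ⟨PositiveLinearMap.mk₀ (ω : B →ₗ[ℂ] ℂ) fun a ha =>
    nonneg_of_norm_le_one ω ?_ hω1 ha, hωκ⟩
  rw [hn]
  exact LinearMap.mkContinuous_norm_le _ zero_le_one _

end States

/-! ### Point evaluations as limits of translated states -/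

section Boundary

variable {Γ : Type*} [Group Γ] {X : Type*} [TopologicalSpace X] [MulAction Γ X]
  [ContinuousConstSMul Γ X]

/-- The translate `y ↦ f (g y)` of a continuous function. -/
def translate (g : Γ) (f : C(X, ℂ)) : C(X, ℂ) :=
  f.comp ⟨fun y => g • y, continuous_const_smul g⟩

@[simp]
theorem translate_apply (g : Γ) (f : C(X, ℂ)) (y : X) : translate g f y = f (g • y) := rfl

variable [CompactSpace X] [T2Space X] [MeasurableSpace X] [BorelSpace X]

/-- States of `C(X)` are probability measures (Riesz–Markov–Kakutani); for a boundary, their orbits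
accumulate at every point evaluation. -/
theorem IsTopologicalBoundary.exists_ultrafilter (hX : IsTopologicalBoundary Γ X)
    (ρ : C(X, ℂ) →ₗ[ℂ] ℂ) (hpos : ∀ f, 0 ≤ ρ (star f * f)) (h1 : ρ 1 = 1) (y : X) :
    ∃ 𝒰 : Ultrafilter Γ, ∀ f, Tendsto (fun g => ρ (translate g f)) (𝒰 : Filter Γ) (𝓝 (f y)) := by
  -- The representing measure is built from real functions; `c` includes `C(X, ℝ)` in `C(X, ℂ)`.
  let c : C(X, ℝ) → C(X, ℂ) := fun f => ⟨fun t => (f t : ℂ), by fun_prop⟩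
  have hc_nonneg (f : C(X, ℝ)) (hf : 0 ≤ f) : 0 ≤ ρ (c f) := by
    let s : C(X, ℂ) := ⟨fun t => ((√(f t) : ℝ) : ℂ), by fun_prop⟩
    have : c f = star s * s := by
      ext t
      simp only [c, s, ContinuousMap.coe_mk, ContinuousMap.mul_apply, ContinuousMap.star_apply,
        Complex.star_def, Complex.conj_ofReal]
      rw [← Complex.ofReal_mul, Real.mul_self_sqrt (show 0 ≤ f t from hf t)]
    rw [this]
    exact hpos s
  have hc_add (f g : C(X, ℝ)) : c (f + g) = c f + c g := by ext t; simp [c]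
  have hc_smul (r : ℝ) (f : C(X, ℝ)) : c (r • f) = (r : ℂ) • c f := by ext t; simp [c]
  have hc_im (f : C(X, ℝ)) : (ρ (c f)).im = 0 := by
    have h2 : f = (f ⊔ 0) + (-1 : ℝ) • ((-f) ⊔ 0) := by
      ext t
      simp only [ContinuousMap.add_apply, ContinuousMap.sup_apply, ContinuousMap.zero_apply,
        ContinuousMap.smul_apply, ContinuousMap.neg_apply, smul_eq_mul]
      rcases le_total 0 (f t) with h | h
      · rw [sup_of_le_left h, sup_of_le_right (neg_nonpos.mpr h)]; ring
      · rw [sup_of_le_right h, sup_of_le_left (neg_nonneg.mpr h)]; ring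
    rw [h2, hc_add, hc_smul, map_add, map_smul, smul_eq_mul, Complex.add_im,
      Complex.im_ofReal_mul, ← (Complex.nonneg_iff.mp (hc_nonneg (f ⊔ 0) le_sup_right)).2,
      ← (Complex.nonneg_iff.mp (hc_nonneg (-f ⊔ 0) le_sup_right)).2]
    simp
  let Λ : CompactlySupportedContinuousMap X ℝ →ₚ[ℝ] ℝ :=
    PositiveLinearMap.mk₀
      { toFun := fun f => (ρ (c f.toContinuousMap)).re
        map_add' := fun f g => by
          rw [← Complex.add_re, ← map_add, ← hc_add]; rfl
        map_smul' := fun r f => by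
          rw [RingHom.id_apply, smul_eq_mul, ← Complex.re_ofReal_mul, ← smul_eq_mul, ← map_smul,
            ← hc_smul]
          rfl }
      fun f hf => (Complex.nonneg_iff.mp (hc_nonneg f.toContinuousMap hf)).1
  let μ : MeasureTheory.Measure X := RealRMK.rieszMeasure Λ
  have hμ (f : C(X, ℝ)) : ((∫ t, f t ∂μ : ℝ) : ℂ) = ρ (c f) := by
    have h := RealRMK.integral_rieszMeasure Λ
      ⟨f, HasCompactSupport.of_compactSpace _⟩
    apply Complex.ext
    · rw [Complex.ofReal_re]
      exact h
    · rw [Complex.ofReal_im, hc_im]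
  have hc1 : c 1 = 1 := by ext t; simp [c]
  have hμ1 : MeasureTheory.IsProbabilityMeasure μ := by
    have h := hμ 1
    rw [hc1, h1] at h
    have h2 : μ.real Set.univ = 1 := by
      have : ∫ t, (1 : C(X, ℝ)) t ∂μ = 1 := by exact_mod_cast h
      simpa using this
    constructor
    rw [MeasureTheory.measureReal_def, ENNReal.toReal_eq_one_iff] at h2
    exact h2
  let ν : MeasureTheory.ProbabilityMeasure X := ⟨μ, hμ1⟩
  let F : Γ → MeasureTheory.ProbabilityMeasure X := fun g =>
    ν.map (f := fun y : X => g • y)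
      (continuous_const_smul g).measurable.aemeasurable
  have hne : (comap F (𝓝 (MeasureTheory.diracProba y))).NeBot := by
    refine comap_neBot_iff.mpr fun t ht => ?_
    obtain ⟨_, hz, ⟨g, rfl⟩⟩ := mem_closure_iff_nhds.mp (hX ν y) t ht
    exact ⟨g, hz⟩
  let 𝒰 : Ultrafilter Γ := Ultrafilter.of (comap F (𝓝 (MeasureTheory.diracProba y)))
  have ht : Tendsto F (𝒰 : Filter Γ) (𝓝 (MeasureTheory.diracProba y)) :=
    tendsto_comap.mono_left (Ultrafilter.of_le _)
  rw [MeasureTheory.ProbabilityMeasure.tendsto_iff_forall_integral_tendsto] at ht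
  have hreal (f : C(X, ℝ)) :
      Tendsto (fun g : Γ => ρ (translate g (c f))) (𝒰 : Filter Γ) (𝓝 (f y : ℂ)) := by
    have h2 := (Complex.continuous_ofReal.tendsto _).comp
      (ht (BoundedContinuousFunction.mkOfCompact f))
    have h3 : ∫ t, BoundedContinuousFunction.mkOfCompact f t
        ∂(MeasureTheory.diracProba y : MeasureTheory.Measure X) = f y := by
      exact MeasureTheory.integral_dirac _ _
    rw [h3] at h2
    refine h2.congr fun g => ?_
    have h4 : ∫ t, BoundedContinuousFunction.mkOfCompact f t ∂(F g : MeasureTheory.Measure X) =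
        ∫ t, f (g • t) ∂μ := by
      rw [MeasureTheory.ProbabilityMeasure.toMeasure_map, MeasureTheory.integral_map
        (continuous_const_smul g).measurable.aemeasurable
        (BoundedContinuousFunction.continuous _).aestronglyMeasurable]
      rfl
    rw [Function.comp_apply, h4]
    exact hμ (f.comp ⟨fun t => g • t, continuous_const_smul g⟩)
  refine ⟨𝒰, fun f => ?_⟩
  let fr : C(X, ℝ) := ⟨fun t => (f t).re, by fun_prop⟩
  let fi : C(X, ℝ) := ⟨fun t => (f t).im, by fun_prop⟩
  have hf : f = c fr + Complex.I • c fi := by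
    ext t
    simp only [c, fr, fi, ContinuousMap.add_apply, ContinuousMap.smul_apply, ContinuousMap.coe_mk,
      smul_eq_mul]
    rw [mul_comm, Complex.re_add_im]
  have h2 := (hreal fr).add ((hreal fi).const_mul Complex.I)
  have h3 : ((fr y : ℝ) : ℂ) + Complex.I * ((fi y : ℝ) : ℂ) = f y := by
    rw [mul_comm]; exact Complex.re_add_im _
  rw [h3] at h2
  refine h2.congr fun g => ?_
  conv_rhs => rw [hf]
  rw [← smul_eq_mul, ← map_smul, ← map_add]
  rfl

end Boundary

/-! ### Dense ⋆-subalgebras -/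

section Generation

variable {B C : Type*} [CStarAlgebra B] [CStarAlgebra C]

theorem adjoin_closure_induction {S : Set B}
    (hS : (StarAlgebra.adjoin ℂ S).topologicalClosure = ⊤) {p : B → Prop}
    (closed : IsClosed {b | p b}) (mem : ∀ a ∈ S, p a)
    (algebraMap : ∀ r : ℂ, p (algebraMap ℂ B r)) (add : ∀ a b, p a → p b → p (a + b))
    (mul : ∀ a b, p a → p b → p (a * b)) (star : ∀ a, p a → p (star a)) (b : B) : p b := by
  have hle : (StarAlgebra.adjoin ℂ S : Set B) ⊆ {b | p b} := by
    intro a ha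
    induction ha using StarAlgebra.adjoin_induction with
    | mem x hx => exact mem x hx
    | algebraMap r => exact algebraMap r
    | add x y hx hy ihx ihy => exact add _ _ ihx ihy
    | mul x y hx hy ihx ihy => exact mul _ _ ihx ihy
    | star x hx ih => exact star _ ih
  have hb : b ∈ (StarAlgebra.adjoin ℂ S).topologicalClosure := hS ▸ trivial
  exact closure_minimal hle closed hb

theorem starAlgHom_ext_of_adjoin {S : Set B}
    (hS : (StarAlgebra.adjoin ℂ S).topologicalClosure = ⊤) {φ ψ : B →⋆ₐ[ℂ] C}
    (h : ∀ a ∈ S, φ a = ψ a) : φ = ψ := by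
  ext b
  refine adjoin_closure_induction hS (p := fun b => φ b = ψ b)
    (isClosed_eq (map_continuous φ) (map_continuous ψ)) h (fun r => ?_)
    (fun a b ha hb => ?_) (fun a b ha hb => ?_) (fun a ha => ?_) b
  · rw [AlgHomClass.commutes, AlgHomClass.commutes]
  · rw [map_add, map_add, ha, hb]
  · rw [map_mul, map_mul, ha, hb]
  · rw [map_star, map_star, ha]

/-- An isomorphism over `M` is `M`-bimodular. -/
theorem apply_mul_mul_of_apply_eq {M B B' : Type*} [Semiring B] [Algebra ℂ B]
    [Star B] [Semiring B'] [Algebra ℂ B'] [Star B'] (Φ : B ≃⋆ₐ[ℂ] B') {ι : M → B} {ι' : M → B'}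
    (h : ∀ m, Φ (ι m) = ι' m) (m n : M) (b : B) :
    Φ (ι m * b * ι n) = ι' m * Φ b * ι' n := by
  rw [map_mul, map_mul, h, h]

end Generation

/-! ### Isometries between Hilbert spaces and the GNS construction -/

section GNS

/-- Two linear maps with the same Gram form, one of them with dense range, differ by an isometry. -/
theorem exists_isometry_of_inner_eq {E H K : Type*} [AddCommGroup E] [Module ℂ E]
    [NormedAddCommGroup H] [InnerProductSpace ℂ H] [CompleteSpace H] [NormedAddCommGroup K]
    [InnerProductSpace ℂ K] [CompleteSpace K] {e : E →ₗ[ℂ] H} (he : DenseRange e) (f : E →ₗ[ℂ] K)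
    (h : ∀ a b, ⟪f a, f b⟫_ℂ = ⟪e a, e b⟫_ℂ) :
    ∃ V : H →L[ℂ] K, V.adjoint ∘L V = 1 ∧ ∀ a, V (e a) = f a := by
  have hV (a : E) : f.extendOfNorm e (e a) = f a := by
    refine LinearMap.extendOfNorm_eq he ⟨1, fun a => le_of_eq ?_⟩ a
    rw [one_mul, @norm_eq_sqrt_re_inner ℂ, @norm_eq_sqrt_re_inner ℂ _ _ _ _ (e a), h]
  refine ⟨f.extendOfNorm e, ContinuousLinearMap.ext fun η => ext_inner_left ℂ fun ζ => ?_, hV⟩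
  rw [ContinuousLinearMap.comp_apply, ContinuousLinearMap.adjoint_inner_right, one_apply_eq_self]
  refine he.induction_on₂
    (p := fun ζ η => ⟪f.extendOfNorm e ζ, f.extendOfNorm e η⟫_ℂ = ⟪ζ, η⟫_ℂ)
    (isClosed_eq (by fun_prop) (by fun_prop)) (fun a b => ?_) ζ η
  rw [hV, hV, h]

variable {A : Type*} [CStarAlgebra A] [PartialOrder A] [StarOrderedRing A] {τ : A →ₚ[ℂ] ℂ}

/-- The vector of `a ∈ A` in the Hilbert space of the GNS construction of `τ`, linear in `a`. -/
def gnsVec (τ : A →ₚ[ℂ] ℂ) : A →ₗ[ℂ] τ.GNS :=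
  (UniformSpace.Completion.toComplL : τ.PreGNS →L[ℂ] τ.GNS).toLinearMap ∘ₗ
    (τ.toPreGNS : A →ₗ[ℂ] τ.PreGNS)

theorem denseRange_gnsVec : DenseRange (gnsVec τ) :=
  UniformSpace.Completion.denseRange_coe.comp τ.toPreGNS.surjective.denseRange
    (UniformSpace.Completion.continuous_coe _)

theorem gnsStarAlgHom_gnsVec (a b : A) : τ.gnsStarAlgHom a (gnsVec τ b) = gnsVec τ (a * b) := by
  change τ.gnsNonUnitalStarAlgHom a ((τ.toPreGNS b : τ.PreGNS) : τ.GNS) = _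
  rw [τ.gnsNonUnitalStarAlgHom_apply_coe]
  rfl

theorem inner_gnsVec (a b : A) : ⟪gnsVec τ a, gnsVec τ b⟫_ℂ = τ (star a * b) := by
  change ⟪((τ.toPreGNS a : τ.PreGNS) : τ.GNS), ((τ.toPreGNS b : τ.PreGNS) : τ.GNS)⟫_ℂ = _
  rw [UniformSpace.Completion.inner_coe, τ.preGNS_inner_def]
  rfl

end GNS

/-! ### Covariant models and their states -/

section Model

variable {H : Type*} [NormedAddCommGroup H] [InnerProductSpace ℂ H] [CompleteSpace H]
  {Γ : Type*} [Group Γ] {X : Type*} [TopologicalSpace X] [MulAction Γ X] [ContinuousConstSMul Γ X]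
  {M : Type*} [CStarAlgebra M] {B : Type*} [CStarAlgebra B]

/-- The operator `m` intertwines each `Θ x` with its translate by `g`. -/
def Translates (Θ : X → C(X, ℂ) → H →L[ℂ] H) (g : Γ) (m : H →L[ℂ] H) : Prop :=
  ∀ x f, Θ x f * m = m * Θ x (translate g f)

/-- The features of `M = Γ ⋉ A` acting on `ℓ²(Γ, L²(A))` and of the Poisson transforms
`Θ x = P_{δ_x} ⊗ 1` on which the rigidity of `M ⊂ B_X^x` rests: the isometries `U g` of `M`
intertwine `Θ x` with its translates, the vector `ξ` is an eigenvector of `Θ x f` with eigenvalue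
`f x`, the vector state of `ξ` on `M` is invariant under conjugation by `U g`, and `ξ` is cyclic
for the elements of `M` that intertwine all `Θ x` with one of their translates. -/
structure IsCovariantModel (r : M →⋆ₐ[ℂ] (H →L[ℂ] H)) (U : Γ → M) (ξ : H)
    (Θ : X → C(X, ℂ) →⋆ₐ[ℂ] (H →L[ℂ] H)) : Prop where
  star_mul_self : ∀ g, star (U g) * U g = 1
  norm_eq_one : ‖ξ‖ = 1
  apply_vec : ∀ x f, Θ x f ξ = f x • ξ
  translates : ∀ g, Translates (fun x => Θ x) g (r (U g))
  invariant : ∀ g m, ⟪r (U g) ξ, r m (r (U g) ξ)⟫_ℂ = ⟪ξ, r m ξ⟫_ℂ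
  dense : Dense (Submodule.span ℂ {v : H | ∃ m, (∃ g : Γ, Translates (fun x => Θ x) g (r m)) ∧
    r m ξ = v} : Set H)

/-- `j` is a faithful representation of `B` whose range is the C⋆-algebra generated by the range
of `r` and the range of `θ₀`; the corresponding maps into `B` are `ι` and `θ`. -/
structure IsGeneratedBy (r : M →⋆ₐ[ℂ] (H →L[ℂ] H)) (θ₀ : C(X, ℂ) →⋆ₐ[ℂ] (H →L[ℂ] H))
    (j : B →⋆ₐ[ℂ] (H →L[ℂ] H)) (ι : M →⋆ₐ[ℂ] B) (θ : C(X, ℂ) →⋆ₐ[ℂ] B) : Prop where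
  injective : Function.Injective j
  apply_incl : ∀ m, j (ι m) = r m
  apply_func : ∀ f, j (θ f) = θ₀ f
  closure_eq_top :
    (StarAlgebra.adjoin ℂ (Set.range ι ∪ Set.range θ)).topologicalClosure = ⊤

variable {r : M →⋆ₐ[ℂ] (H →L[ℂ] H)} {U : Γ → M} {ξ : H} {Θ : X → C(X, ℂ) →⋆ₐ[ℂ] (H →L[ℂ] H)}

theorem IsCovariantModel.denseRange (h : IsCovariantModel r U ξ Θ) :
    DenseRange fun m : M => r m ξ := by
  let e : M →ₗ[ℂ] H :=
    (ContinuousLinearMap.apply ℂ H ξ : (H →L[ℂ] H) →ₗ[ℂ] H) ∘ₗ (r : M →ₗ[ℂ] (H →L[ℂ] H))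
  have : (Submodule.span ℂ {v : H | ∃ m, (∃ g : Γ, Translates (fun x => Θ x) g (r m)) ∧
      r m ξ = v}) ≤ LinearMap.range e := by
    refine Submodule.span_le.mpr ?_
    rintro _ ⟨m, -, rfl⟩
    exact ⟨m, rfl⟩
  exact h.dense.mono this

variable [PartialOrder B] [StarOrderedRing B]

/-- If a state `χ` of `B = C⋆(M, Θ x)` is the vector state of `ξ` on `M` and evaluation at `y` on
`C(X)`, then its GNS representation compresses to a representation on the space of `ξ` that is the
given one on `M` and maps `Θ x f` to `Θ y f`. -/
theorem IsCovariantModel.exists_starAlgHom (h : IsCovariantModel r U ξ Θ) {x : X}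
    {j : B →⋆ₐ[ℂ] (H →L[ℂ] H)} {ι : M →⋆ₐ[ℂ] B} {θ : C(X, ℂ) →⋆ₐ[ℂ] B}
    (hB : IsGeneratedBy r (Θ x) j ι θ) (y : X) (χ : B →ₚ[ℂ] ℂ)
    (hM : ∀ m, χ (ι m) = ⟪ξ, r m ξ⟫_ℂ) (hX : ∀ f, χ (θ f) = f y) :
    ∃ Q : B →⋆ₐ[ℂ] (H →L[ℂ] H), (∀ m, Q (ι m) = r m) ∧ (∀ f, Q (θ f) = Θ y f) ∧
      ∀ (c d : M) (b : B), χ (star (ι c) * b * ι d) = ⟪r c ξ, Q b (r d ξ)⟫_ℂ := by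
  let π : B →⋆ₐ[ℂ] (χ.GNS →L[ℂ] χ.GNS) := χ.gnsStarAlgHom
  have hπ (a b) : π a (gnsVec χ b) = gnsVec χ (a * b) := gnsStarAlgHom_gnsVec a b
  let e : M →ₗ[ℂ] H :=
    (ContinuousLinearMap.apply ℂ H ξ : (H →L[ℂ] H) →ₗ[ℂ] H) ∘ₗ (r : M →ₗ[ℂ] (H →L[ℂ] H))
  have he (m : M) : e m = r m ξ := rfl
  have hed : DenseRange e := h.denseRange
  obtain ⟨V, hVV, hV⟩ := exists_isometry_of_inner_eq hed (gnsVec χ ∘ₗ (ι : M →ₗ[ℂ] B))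
    fun a b => by
      change ⟪gnsVec χ (ι a), gnsVec χ (ι b)⟫_ℂ = _
      rw [inner_gnsVec, ← map_star, ← map_mul, hM, he, he, map_mul, map_star,
        ContinuousLinearMap.star_eq_adjoint, mul_apply_eq_comp,
        ContinuousLinearMap.adjoint_inner_right]
  replace hV (m : M) : V (e m) = gnsVec χ (ι m) := hV m
  -- `V` intertwines `π` with `r` on `M`, and with `Θ y` on `C(X)`.
  have hVM (m : M) : π (ι m) ∘L V = V ∘L r m := by
    refine ContinuousLinearMap.ext fun η => ?_
    refine hed.induction_on (p := fun η => (π (ι m) ∘L V) η = (V ∘L r m) η) η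
      (isClosed_eq (by fun_prop) (by fun_prop)) (fun a => ?_)
    have : r m (e a) = e (m * a) := by rw [he, he, map_mul, mul_apply_eq_comp]
    rw [ContinuousLinearMap.comp_apply, ContinuousLinearMap.comp_apply, this, hV, hV, hπ,
      map_mul ι]
  -- `χ` is multiplicative on `C(X)`, so its GNS vector is a joint eigenvector.
  have hθ1 (f : C(X, ℂ)) : gnsVec χ (θ f) = f y • gnsVec χ 1 := by
    rw [← sub_eq_zero, ← inner_self_eq_zero (𝕜 := ℂ), ← map_smul, ← map_sub, inner_gnsVec]
    have : θ f - f y • 1 = θ (f - f y • 1) := by rw [map_sub, map_smul, map_one]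
    rw [this, ← map_star, ← map_mul, hX]
    simp
  have hVX (f : C(X, ℂ)) : π (θ f) ∘L V = V ∘L (Θ y f) := by
    refine ContinuousLinearMap.ext_on h.dense ?_
    rintro _ ⟨m, ⟨g, hm⟩, rfl⟩
    have hcov : θ f * ι m = ι m * θ (translate g f) := by
      refine hB.injective ?_
      rw [map_mul, map_mul, hB.apply_func, hB.apply_func, hB.apply_incl]
      exact hm x f
    have h1 : Θ y f (e m) = f (g • y) • e m := by
      change (Θ y f * r m) ξ = _
      rw [hm y f, mul_apply_eq_comp, h.apply_vec, map_smul]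
      rfl
    rw [← he, ContinuousLinearMap.comp_apply, ContinuousLinearMap.comp_apply, h1, map_smul, hV, hπ,
      hcov, ← hπ, hθ1, map_smul, hπ, mul_one, translate_apply]
  -- The range of `V` reduces `π`, so compression to it is multiplicative.
  have hp (b : B) : π b ∘L (V ∘L V.adjoint) = (V ∘L V.adjoint) ∘L π b := by
    have hgen (b : B) (T : H →L[ℂ] H) (h1 : π b ∘L V = V ∘L T)
        (h2 : π (star b) ∘L V = V ∘L star T) :
        π b ∘L (V ∘L V.adjoint) = (V ∘L V.adjoint) ∘L π b := by
      have h3 := congrArg ContinuousLinearMap.adjoint h2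
      rw [ContinuousLinearMap.adjoint_comp, ContinuousLinearMap.adjoint_comp, map_star,
        ContinuousLinearMap.star_eq_adjoint, ContinuousLinearMap.star_eq_adjoint,
        ContinuousLinearMap.adjoint_adjoint, ContinuousLinearMap.adjoint_adjoint] at h3
      rw [← ContinuousLinearMap.comp_assoc, h1, ContinuousLinearMap.comp_assoc,
        ContinuousLinearMap.comp_assoc, h3]
    have hπc : Continuous π := map_continuous π
    refine adjoin_closure_induction hB.closure_eq_top
      (p := fun b => π b ∘L (V ∘L V.adjoint) = (V ∘L V.adjoint) ∘L π b)
      (isClosed_eq (by fun_prop) (by fun_prop)) ?_ (fun z => ?_)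
      (fun a b ha hb => ?_) (fun a b ha hb => ?_) (fun a ha => ?_) b
    · rintro _ (⟨m, rfl⟩ | ⟨f, rfl⟩)
      · refine hgen _ (r m) (hVM m) ?_
        rw [← map_star, ← map_star]
        exact hVM (star m)
      · refine hgen _ (Θ y f) (hVX f) ?_
        rw [← map_star, ← map_star]
        exact hVX (star f)
    · rw [AlgHomClass.commutes]
      ext η
      simp [Algebra.algebraMap_eq_smul_one]
    · rw [map_add, ContinuousLinearMap.add_comp, ContinuousLinearMap.comp_add, ha, hb]
    · change π (a * b) * _ = _ * π (a * b)
      change π a * _ = _ * π a at ha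
      change π b * _ = _ * π b at hb
      rw [map_mul, mul_assoc, hb, ← mul_assoc, ha, mul_assoc]
    · have h3 := congrArg ContinuousLinearMap.adjoint ha
      rw [map_star, ContinuousLinearMap.star_eq_adjoint]
      simp only [ContinuousLinearMap.adjoint_comp, ContinuousLinearMap.adjoint_adjoint] at h3
      exact h3.symm
  have hQ (b : B) (T : H →L[ℂ] H) (h1 : π b ∘L V = V ∘L T) :
      V.adjoint ∘L π b ∘L V = T := by
    rw [h1, ← ContinuousLinearMap.comp_assoc, hVV]
    rfl
  let Q : B →⋆ₐ[ℂ] (H →L[ℂ] H) :=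
    { toFun := fun b => V.adjoint ∘L π b ∘L V
      map_one' := by
        refine hQ _ _ ?_
        rw [map_one]; rfl
      map_mul' := fun a b => by
        have h1 := hp b
        calc V.adjoint ∘L π (a * b) ∘L V
            = V.adjoint ∘L π a ∘L π b ∘L V ∘L (V.adjoint ∘L V) := by
              rw [hVV, map_mul]; rfl
          _ = V.adjoint ∘L π a ∘L (π b ∘L (V ∘L V.adjoint)) ∘L V := rfl
          _ = _ := by rw [h1]; rfl
      map_zero' := by rw [map_zero]; simp
      map_add' := fun a b => by
        rw [map_add, ContinuousLinearMap.add_comp, ContinuousLinearMap.comp_add]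
      commutes' := fun z => by
        refine hQ _ _ ?_
        rw [AlgHomClass.commutes]
        ext η
        simp [Algebra.algebraMap_eq_smul_one]
      map_star' := fun b => by
        rw [map_star, ContinuousLinearMap.star_eq_adjoint, ContinuousLinearMap.star_eq_adjoint]
        simp only [ContinuousLinearMap.adjoint_comp, ContinuousLinearMap.adjoint_adjoint]
        rfl }
  refine ⟨Q, fun m => hQ _ _ (hVM m), fun f => hQ _ _ (hVX f), fun c d b => ?_⟩
  change _ = ⟪e c, V.adjoint (π b (V (e d)))⟫_ℂ
  rw [ContinuousLinearMap.adjoint_inner_right, hV, hV, hπ, inner_gnsVec, mul_assoc]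

end Model

/-! ### Matrices of operators -/

section OperatorMatrices

variable {H : Type*} [NormedAddCommGroup H] [InnerProductSpace ℂ H] {n : Type*} [Fintype n]

/-- The operator on the Hilbert sum of `n` copies of `H` given by a matrix of operators on `H`. -/
def matrixOp (T : n → n → H →L[ℂ] H) :
    PiLp 2 (fun _ : n => H) →L[ℂ] PiLp 2 (fun _ : n => H) :=
  ((PiLp.continuousLinearEquiv 2 ℂ (fun _ : n => H)).symm : (n → H) →L[ℂ] _) ∘L
    ContinuousLinearMap.pi fun i => ∑ j, T i j ∘L PiLp.proj 2 (fun _ : n => H) j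

theorem matrixOp_apply (T : n → n → H →L[ℂ] H) (v : PiLp 2 (fun _ : n => H)) (i : n) :
    matrixOp T v i = ∑ j, T i j (v j) := by
  simp [matrixOp]

theorem inner_matrixOp (T : n → n → H →L[ℂ] H) (v w : PiLp 2 (fun _ : n => H)) :
    ⟪v, matrixOp T w⟫_ℂ = ∑ i, ∑ j, ⟪v i, T i j (w j)⟫_ℂ := by
  simp [PiLp.inner_apply, matrixOp_apply, inner_sum]

variable [CompleteSpace H] {B : Type*} [CStarAlgebra B]

/-- The amplification to matrices of a representation on `H`. -/
def matrixRep (j : B →⋆ₐ[ℂ] (H →L[ℂ] H)) : CStarMatrix n n B →⋆ₙₐ[ℂ]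
    (PiLp 2 (fun _ : n => H) →L[ℂ] PiLp 2 (fun _ : n => H)) where
  toFun T := matrixOp fun a b => j (T a b)
  map_zero' := by
    ext v i
    simp [matrixOp_apply]
  map_add' S T := by
    ext v i
    simp [matrixOp_apply, Finset.sum_add_distrib]
  map_smul' z T := by
    ext v i
    simp [matrixOp_apply, Finset.smul_sum]
  map_mul' S T := by
    ext v i
    simp only [matrixOp_apply, CStarMatrix.mul_apply, map_sum, map_mul, mul_apply_eq_comp,
      sum_apply]
    exact Finset.sum_comm
  map_star' T := by
    rw [ContinuousLinearMap.star_eq_adjoint, ContinuousLinearMap.eq_adjoint_iff]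
    intro v w
    rw [inner_matrixOp, ← inner_conj_symm, inner_matrixOp]
    simp only [map_sum, inner_conj_symm]
    rw [Finset.sum_comm]
    refine Finset.sum_congr rfl fun a _ => Finset.sum_congr rfl fun b _ => ?_
    rw [CStarMatrix.star_apply, map_star, ContinuousLinearMap.star_eq_adjoint,
      ContinuousLinearMap.adjoint_inner_left]

theorem inner_matrixRep (j : B →⋆ₐ[ℂ] (H →L[ℂ] H)) (T : CStarMatrix n n B)
    (v w : PiLp 2 (fun _ : n => H)) :
    ⟪v, matrixRep j T w⟫_ℂ = ∑ a, ∑ b, ⟪v a, j (T a b) (w b)⟫_ℂ :=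
  inner_matrixOp _ v w

/-- The norm of a matrix over `B` is bounded by the norm of the sesquilinear form that it defines
on a dense subspace of the space of a faithful representation of `B`. -/
theorem norm_le_of_dense_inner_le [DecidableEq n] [PartialOrder B] [StarOrderedRing B]
    {j : B →⋆ₐ[ℂ] (H →L[ℂ] H)} (hj : Function.Injective j)
    {E : Type*} {e : E → H} (he : DenseRange e) (T : CStarMatrix n n B) {K : ℝ} (hK : 0 ≤ K)
    (h : ∀ c d : n → E, ‖∑ a, ∑ b, ⟪e (c a), j (T a b) (e (d b))⟫_ℂ‖ ≤
      K * (√(∑ a, ‖e (c a)‖ ^ 2) * √(∑ a, ‖e (d a)‖ ^ 2))) : ‖T‖ ≤ K := by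
  have hinj : Function.Injective (matrixRep (n := n) j) := by
    refine (injective_iff_map_eq_zero _).mpr fun S hS => ?_
    ext a b
    refine hj (ContinuousLinearMap.ext fun η => ?_)
    have h1 : matrixRep j S (PiLp.single 2 b η) a = 0 := by rw [hS]; rfl
    change matrixOp _ _ _ = _ at h1
    rw [matrixOp_apply, Finset.sum_eq_single b] at h1
    · simpa using h1
    · intro b' _ hb
      simp [hb]
    · simp
  rw [← NonUnitalStarAlgHom.norm_map _ hinj]
  have hpi : DenseRange fun c : n → E => (WithLp.toLp 2 fun a => e (c a) : PiLp 2 fun _ : n => H) :=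
    (PiLp.continuousLinearEquiv 2 ℂ fun _ : n => H).symm.surjective.denseRange.comp
      (DenseRange.piMap fun _ => he) (PiLp.continuousLinearEquiv 2 ℂ fun _ : n => H).symm.continuous
  have hall (v w : PiLp 2 fun _ : n => H) : ‖⟪v, matrixRep j T w⟫_ℂ‖ ≤ K * (‖v‖ * ‖w‖) := by
    refine hpi.induction_on₂ (p := fun v w => ‖⟪v, matrixRep j T w⟫_ℂ‖ ≤ K * (‖v‖ * ‖w‖))
      (isClosed_le (by fun_prop) (by fun_prop)) (fun c d => ?_) v w
    rw [inner_matrixRep, PiLp.norm_eq_of_L2, PiLp.norm_eq_of_L2]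
    exact h c d
  refine ContinuousLinearMap.opNorm_le_bound _ hK fun w => ?_
  have h1 := hall (matrixRep j T w) w
  rw [inner_self_eq_norm_sq_to_K, norm_pow, RCLike.norm_ofReal, abs_norm] at h1
  rcases (norm_nonneg (matrixRep j T w)).eq_or_lt with h0 | h0
  · rw [← h0]; positivity
  · refine le_of_mul_le_mul_left ?_ h0
    linarith

end OperatorMatrices

/-! ### Rigidity of covariant models over a boundary -/

section Rigidity

variable {H : Type*} [NormedAddCommGroup H] [InnerProductSpace ℂ H] [CompleteSpace H]
  {Γ : Type*} [Group Γ] {X : Type*} [TopologicalSpace X] [MulAction Γ X] [ContinuousConstSMul Γ X]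
  [CompactSpace X] [T2Space X] [MeasurableSpace X] [BorelSpace X]
  {M : Type u} [CStarAlgebra M] {B : Type v} [CStarAlgebra B] [PartialOrder B] [StarOrderedRing B]
  {r : M →⋆ₐ[ℂ] (H →L[ℂ] H)} {U : Γ → M} {ξ : H} {Θ : X → C(X, ℂ) →⋆ₐ[ℂ] (H →L[ℂ] H)}
  {x : X} {j : B →⋆ₐ[ℂ] (H →L[ℂ] H)} {ι : M →⋆ₐ[ℂ] B} {θ : C(X, ℂ) →⋆ₐ[ℂ] B}

/-- Conjugating a state `ρ` of `B = C⋆(M, Θ x)` that is the vector state of `ξ` on `M` by suitable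
`U g` moves it towards a state whose restriction to `C(X)` is a given point evaluation. -/
theorem IsCovariantModel.exists_ultrafilter (h : IsCovariantModel r U ξ Θ)
    (hB : IsGeneratedBy r (Θ x) j ι θ) (hX : IsTopologicalBoundary Γ X) (ρ : B →ₚ[ℂ] ℂ)
    (hρ : ∀ m, ρ (ι m) = ⟪ξ, r m ξ⟫_ℂ) (y : X) :
    ∃ (𝒰 : Ultrafilter Γ) (Q : B →⋆ₐ[ℂ] (H →L[ℂ] H)), (∀ m, Q (ι m) = r m) ∧
      (∀ f, Q (θ f) = Θ y f) ∧ ∀ (c d : M) (b : B),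
        Tendsto (fun g => ρ (star (ι (c * U g)) * b * ι (d * U g))) (𝒰 : Filter Γ)
          (𝓝 ⟪r c ξ, Q b (r d ξ)⟫_ℂ) := by
  have hρ1 : ρ 1 = 1 := by
    rw [← map_one ι, hρ, map_one, one_apply_eq_self, inner_self_eq_norm_sq_to_K, h.norm_eq_one]
    simp
  obtain ⟨𝒰, h𝒰⟩ := hX.exists_ultrafilter (ρ.toLinearMap ∘ₗ (θ : C(X, ℂ) →ₗ[ℂ] B)) (fun f => by
    change 0 ≤ ρ (θ (star f * f))
    rw [map_mul, map_star]
    exact ρ.map_nonneg (star_mul_self_nonneg _)) (by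
    change ρ (θ 1) = 1
    rw [map_one, hρ1]) y
  let χ : Γ → B →ₚ[ℂ] ℂ := fun g => PositiveLinearMap.mk₀
    (ρ.toLinearMap ∘ₗ LinearMap.mulRight ℂ (ι (U g)) ∘ₗ LinearMap.mulLeft ℂ (star (ι (U g))))
    fun b hb => ρ.map_nonneg (star_left_conjugate_nonneg hb _)
  have hχ (g : Γ) (b : B) : χ g b = ρ (star (ι (U g)) * b * ι (U g)) := rfl
  obtain ⟨χ', hχ'⟩ := exists_ultralimit 𝒰 χ fun g => by
    rw [hχ, mul_one, ← map_star, ← map_mul, h.star_mul_self, map_one, hρ1]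
  have hM (m : M) : χ' (ι m) = ⟪ξ, r m ξ⟫_ℂ := by
    refine tendsto_nhds_unique (hχ' (ι m)) (tendsto_const_nhds.congr fun g => ?_)
    rw [hχ, ← map_star, ← map_mul, ← map_mul, hρ, ← h.invariant g m, map_mul, map_mul, map_star,
      mul_apply_eq_comp, mul_apply_eq_comp, ContinuousLinearMap.star_eq_adjoint,
      ContinuousLinearMap.adjoint_inner_right]
  have hθ (f : C(X, ℂ)) : χ' (θ f) = f y := by
    refine tendsto_nhds_unique (hχ' (θ f)) ((h𝒰 f).congr fun g => ?_)
    have hcov : θ f * ι (U g) = ι (U g) * θ (translate g f) := by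
      refine hB.injective ?_
      rw [map_mul, map_mul, hB.apply_func, hB.apply_func, hB.apply_incl]
      exact h.translates g x f
    rw [hχ, mul_assoc, hcov, ← mul_assoc, ← map_star, ← map_mul, h.star_mul_self, map_one, one_mul]
    rfl
  obtain ⟨Q, hQM, hQX, hQ⟩ := h.exists_starAlgHom hB y χ' hM hθ
  refine ⟨𝒰, Q, hQM, hQX, fun c d b => ?_⟩
  rw [← hQ]
  refine (hχ' _).congr fun g => ?_
  rw [hχ]
  simp only [map_mul, star_mul, mul_assoc]

/-- Inclusions arising from a covariant model over a boundary are essential. The vector state of `ξ`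
on `M` extends to a state `ω` of `C`, and the conjugates of `ω ∘ P` by `U g` accumulate at the
vector state of `ξ` on `B`. As these conjugates have the same restriction to `M`, the form that
`P(T)` defines on the vectors `κ c`, of norm at most `‖P(T)‖`, converges to the form of `T`. -/
theorem IsCovariantModel.isEssential (h : IsCovariantModel r U ξ Θ)
    (hr : Function.Injective r)
    (hB : IsGeneratedBy r (Θ x) j ι θ) (hX : IsTopologicalBoundary Γ X) :
    IsEssential.{u, v, w} ι := by
  refine ⟨fun a b hab => hr ?_, ?_⟩
  · rw [← hB.apply_incl, ← hB.apply_incl, hab]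
  intro C _ _ _ κ hκ P hP k T
  refine le_antisymm (norm_map_le P hP.map_one T) ?_
  let φ : M →ₗ[ℂ] ℂ := (innerSL ℂ ξ).toLinearMap ∘ₗ
    (ContinuousLinearMap.apply ℂ H ξ : (H →L[ℂ] H) →ₗ[ℂ] H) ∘ₗ (r : M →ₗ[ℂ] (H →L[ℂ] H))
  have hφ (m : M) : φ m = ⟪ξ, r m ξ⟫_ℂ := rfl
  obtain ⟨ω, hω⟩ := exists_state_extension κ hκ φ (fun m => by
    rw [hφ]
    refine (norm_inner_le_norm _ _).trans ?_
    rw [h.norm_eq_one, one_mul]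
    refine ((r m).le_opNorm ξ).trans ?_
    rw [h.norm_eq_one, mul_one]
    exact NonUnitalStarAlgHom.norm_apply_le r m) (by
    rw [hφ, map_one, one_apply_eq_self, inner_self_eq_norm_sq_to_K, h.norm_eq_one]
    simp)
  have hPκ (m n : M) (b : B) : P (star (ι m) * b * ι n) = star (κ m) * P b * κ n := by
    rw [← map_star, ← map_star, hP.bimodular]
  have hPι (m : M) : P (ι m) = κ m := by
    have := hP.bimodular m 1 1
    rwa [map_one ι, map_one κ, mul_one, mul_one, mul_one, hP.map_one, mul_one] at this
  let ρ : B →ₚ[ℂ] ℂ := ω.comp (PositiveLinearMap.ofClass P)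
  have hρ (b : B) : ρ b = ω (P b) := rfl
  obtain ⟨𝒰, Q, hQM, hQX, hQ⟩ := h.exists_ultrafilter hB hX ρ (fun m => by
    rw [hρ, hPι, hω, hφ]) x
  -- `Q` and the given representation agree on the generators.
  have hQj : Q = j := by
    refine starAlgHom_ext_of_adjoin hB.closure_eq_top ?_
    rintro _ (⟨m, rfl⟩ | ⟨f, rfl⟩)
    · rw [hQM, hB.apply_incl]
    · rw [hQX, hB.apply_func]
  subst hQj
  refine norm_le_of_dense_inner_le hB.injective h.denseRange T (norm_nonneg _) fun c d => ?_
  have hlim := (tendsto_finsetSum Finset.univ fun a _ => tendsto_finsetSum Finset.univ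
    fun b _ => hQ (c a) (d b) (T a b)).norm
  refine le_of_tendsto' hlim fun g => ?_
  have hnorm (m : M) : (ω (star (κ (m * U g)) * κ (m * U g))).re = ‖r m ξ‖ ^ 2 := by
    have h1 : star (m * U g) * (m * U g) = star (U g) * (star m * m) * U g := by
      simp only [star_mul, mul_assoc]
    rw [← map_star, ← map_mul, hω, hφ, h1, map_mul, map_mul, mul_apply_eq_comp, mul_apply_eq_comp,
      map_star, ContinuousLinearMap.star_eq_adjoint, ContinuousLinearMap.adjoint_inner_right,
      h.invariant, map_mul, map_star, mul_apply_eq_comp, ContinuousLinearMap.star_eq_adjoint,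
      ContinuousLinearMap.adjoint_inner_right, inner_self_eq_norm_sq_to_K]
    norm_cast
  have key := norm_sum_apply_le ω (T.map P) (fun a => κ (c a * U g)) (fun a => κ (d a * U g))
  simp only [hnorm] at key
  refine le_trans (le_of_eq ?_) key
  simp only [hρ, hPκ, CStarMatrix.map_apply]

/-- The GNS representation of a limit point of the conjugates of the vector state of `ξ` realizes a
⋆-homomorphism between the algebras over two points of a boundary. -/
theorem IsCovariantModel.exists_starAlgHom_of_points (h : IsCovariantModel r U ξ Θ)
    (hX : IsTopologicalBoundary Γ X) (hB : IsGeneratedBy r (Θ x) j ι θ)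
    {B' : Type*} [CStarAlgebra B']
    {y : X} {j' : B' →⋆ₐ[ℂ] (H →L[ℂ] H)} {ι' : M →⋆ₐ[ℂ] B'} {θ' : C(X, ℂ) →⋆ₐ[ℂ] B'}
    (hB' : IsGeneratedBy r (Θ y) j' ι' θ') :
    ∃ Φ : B →⋆ₐ[ℂ] B', (∀ m, Φ (ι m) = ι' m) ∧ ∀ f, Φ (θ f) = θ' f := by
  let φ : B →ₗ[ℂ] ℂ := (innerSL ℂ ξ).toLinearMap ∘ₗ
    (ContinuousLinearMap.apply ℂ H ξ : (H →L[ℂ] H) →ₗ[ℂ] H) ∘ₗ (j : B →ₗ[ℂ] (H →L[ℂ] H))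
  let ρ : B →ₚ[ℂ] ℂ := PositiveLinearMap.mk₀ φ fun b hb => by
    obtain ⟨s, rfl⟩ := CStarAlgebra.nonneg_iff_eq_star_mul_self.mp hb
    change 0 ≤ ⟪ξ, j (star s * s) ξ⟫_ℂ
    rw [map_mul, map_star, mul_apply_eq_comp, ContinuousLinearMap.star_eq_adjoint,
      ContinuousLinearMap.adjoint_inner_right]
    rw [inner_self_eq_norm_sq_to_K]
    exact pow_nonneg (Complex.zero_le_real.mpr (norm_nonneg (j s ξ))) 2
  have hρ (b : B) : ρ b = ⟪ξ, j b ξ⟫_ℂ := rfl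
  obtain ⟨-, Q, hQM, hQX, -⟩ := h.exists_ultrafilter hB hX ρ (fun m => by
    rw [hρ, hB.apply_incl]) y
  have hclosed : IsClosed (j'.range : Set (H →L[ℂ] H)) :=
    (NonUnitalStarAlgHom.isometry j' hB'.injective).isClosedEmbedding.isClosed_range
  have hQ (b : B) : Q b ∈ j'.range := by
    refine adjoin_closure_induction hB.closure_eq_top (p := fun b => Q b ∈ j'.range)
      (hclosed.preimage (map_continuous Q)) ?_ (fun z => ?_) (fun a b ha hb => ?_)
      (fun a b ha hb => ?_) (fun a ha => ?_) b
    · rintro _ (⟨m, rfl⟩ | ⟨f, rfl⟩)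
      · rw [hQM, ← hB'.apply_incl]
        exact ⟨_, rfl⟩
      · rw [hQX, ← hB'.apply_func]
        exact ⟨_, rfl⟩
    · rw [AlgHomClass.commutes]
      exact algebraMap_mem _ z
    · rw [map_add]
      exact add_mem ha hb
    · rw [map_mul]
      exact mul_mem ha hb
    · rw [map_star]
      exact star_mem ha
  let e : B' ≃⋆ₐ[ℂ] j'.range := StarAlgEquiv.ofInjective j' hB'.injective
  have he (a : B') (b : B) (hab : Q b = j' a) : e.symm ⟨Q b, hQ b⟩ = a := by
    rw [StarAlgEquiv.symm_apply_eq]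
    exact Subtype.ext hab
  exact ⟨(e.symm : j'.range →⋆ₐ[ℂ] B').comp (Q.codRestrict _ hQ),
    fun m => he _ _ (by rw [hQM, hB'.apply_incl]), fun f => he _ _ (by rw [hQX, hB'.apply_func])⟩

/-- For two points `x` and `y` of a boundary, the algebras generated by `M` with `Θ x` and with
`Θ y` are isomorphic over `M`. -/
theorem IsCovariantModel.exists_starAlgEquiv (h : IsCovariantModel r U ξ Θ)
    (hX : IsTopologicalBoundary Γ X) (hB : IsGeneratedBy r (Θ x) j ι θ)
    {B' : Type*} [CStarAlgebra B'] [PartialOrder B'] [StarOrderedRing B']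
    {y : X} {j' : B' →⋆ₐ[ℂ] (H →L[ℂ] H)} {ι' : M →⋆ₐ[ℂ] B'} {θ' : C(X, ℂ) →⋆ₐ[ℂ] B'}
    (hB' : IsGeneratedBy r (Θ y) j' ι' θ') :
    ∃ Φ : B ≃⋆ₐ[ℂ] B', ∀ m, Φ (ι m) = ι' m := by
  obtain ⟨Φ, hΦM, hΦX⟩ := h.exists_starAlgHom_of_points hX hB hB'
  obtain ⟨Ψ, hΨM, hΨX⟩ := h.exists_starAlgHom_of_points hX hB' hB
  refine ⟨StarAlgEquiv.ofStarAlgHom Φ Ψ (starAlgHom_ext_of_adjoin hB.closure_eq_top ?_)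
    (starAlgHom_ext_of_adjoin hB'.closure_eq_top ?_), hΦM⟩
  · rintro _ (⟨m, rfl⟩ | ⟨f, rfl⟩)
    · rw [StarAlgHom.comp_apply, hΦM, hΨM, StarAlgHom.coe_id, id_eq]
    · rw [StarAlgHom.comp_apply, hΦX, hΨX, StarAlgHom.coe_id, id_eq]
  · rintro _ (⟨m, rfl⟩ | ⟨f, rfl⟩)
    · rw [StarAlgHom.comp_apply, hΨM, hΦM, StarAlgHom.coe_id, id_eq]
    · rw [StarAlgHom.comp_apply, hΨX, hΦX, StarAlgHom.coe_id, id_eq]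

end Rigidity

/-! ### Operators on `ℓ²(Γ, K)` -/

section WeightedPermutations

variable {Γ : Type u} [Group Γ] {K : Type v} [NormedAddCommGroup K] [InnerProductSpace ℂ K]

theorem weightedPerm_congr {e e' : Γ ≃ Γ} {T T' : Γ → K →L[ℂ] K} {c c' : ℝ}
    {hT : ∀ h, ‖T h‖ ≤ c} {hT' : ∀ h, ‖T' h‖ ≤ c'} (he : ∀ h, e h = e' h)
    (hTT' : ∀ h, T h = T' h) : weightedPerm e T c hT = weightedPerm e' T' c' hT' := by
  ext ξ h
  rw [weightedPerm_apply, weightedPerm_apply, he, hTT']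

theorem leftTranslation_apply (g : Γ) (ξ : Ell2 Γ K) (h : Γ) :
    leftTranslation K g ξ h = ξ (g⁻¹ * h) := rfl

theorem leftTranslation_single [DecidableEq Γ] (g s : Γ) (k : K) :
    leftTranslation K g (lp.single 2 s k) = lp.single 2 (g * s) k := by
  ext h
  rw [leftTranslation_apply, lp.single_apply, lp.single_apply]
  by_cases hh : h = g * s
  · subst hh
    simp
  · rw [Pi.single_eq_of_ne hh, Pi.single_eq_of_ne]
    rwa [Ne, inv_mul_eq_iff_eq_mul]

theorem weightedPerm_single [DecidableEq Γ] (e : Γ ≃ Γ) (T : Γ → K →L[ℂ] K) (c : ℝ)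
    (hT : ∀ h, ‖T h‖ ≤ c) (s : Γ) (k : K) :
    weightedPerm e T c hT (lp.single 2 s k) = lp.single 2 (e.symm s) (T (e.symm s) k) := by
  ext h
  rw [weightedPerm_apply, lp.single_apply, lp.single_apply]
  by_cases hh : h = e.symm s
  · subst hh
    simp
  · rw [Pi.single_eq_of_ne hh, Pi.single_eq_of_ne, map_zero]
    rwa [Ne, ← Equiv.eq_symm_apply]

theorem leftTranslation_mul (g s : Γ) :
    leftTranslation K g * leftTranslation K s = leftTranslation K (g * s) := by
  ext ξ h
  rw [mul_apply_eq_comp, leftTranslation_apply, leftTranslation_apply, leftTranslation_apply,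
    mul_inv_rev, mul_assoc]

variable [CompleteSpace K]

theorem star_weightedPerm (e : Γ ≃ Γ) (T : Γ → K →L[ℂ] K) (c : ℝ) (hT : ∀ h, ‖T h‖ ≤ c) :
    star (weightedPerm e T c hT) = weightedPerm e.symm (fun h => star (T (e.symm h))) c
      (fun _ => (norm_star _).trans_le (hT _)) := by
  symm
  rw [ContinuousLinearMap.star_eq_adjoint, ContinuousLinearMap.eq_adjoint_iff]
  intro ξ η
  rw [lp.inner_eq_tsum, lp.inner_eq_tsum, ← e.tsum_eq]
  refine tsum_congr fun _ => ?_
  rw [weightedPerm_apply, weightedPerm_apply, ContinuousLinearMap.star_eq_adjoint,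
    ContinuousLinearMap.adjoint_inner_left, e.symm_apply_apply]

theorem star_leftTranslation (g : Γ) :
    star (leftTranslation K g) = leftTranslation K g⁻¹ := by
  rw [leftTranslation, star_weightedPerm]
  exact weightedPerm_congr (fun _ => by simp) (fun _ => star_one _)

theorem star_leftTranslation_mul_self (g : Γ) :
    star (leftTranslation K g) * leftTranslation K g = 1 := by
  rw [star_leftTranslation, leftTranslation_mul, inv_mul_cancel]
  ext ξ h
  rw [leftTranslation_apply, inv_one, one_mul]
  rfl

end WeightedPermutations

/-! ### Covariant models on `ℓ²(Γ, K)` -/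

section Poisson

variable {Γ : Type u} [Group Γ] (K : Type v) [NormedAddCommGroup K] [InnerProductSpace ℂ K]
  [CompleteSpace K] {X : Type w} [TopologicalSpace X] [CompactSpace X] [MulAction Γ X]

/-- The ⋆-homomorphism `f ↦ P_{δ_x} f ⊗ 1`. -/
def poissonHom (x : X) : C(X, ℂ) →⋆ₐ[ℂ] (Ell2 Γ K →L[ℂ] Ell2 Γ K) where
  toFun f := mulOp K (poissonDirac Γ x f)
  map_one' := by
    ext ξ h
    exact one_smul ℂ _
  map_mul' f g := by
    ext ξ h
    exact mul_smul _ _ _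
  map_zero' := by
    ext ξ h
    exact zero_smul ℂ _
  map_add' f g := by
    ext ξ h
    exact add_smul _ _ _
  commutes' z := by
    ext ξ h
    rfl
  map_star' f := by
    rw [mulOp, mulOp, star_weightedPerm]
    refine weightedPerm_congr (fun h => rfl) (fun h => ?_)
    change star (f (h • x)) • (1 : K →L[ℂ] K) = star (f (h • x) • (1 : K →L[ℂ] K))
    rw [star_smul, star_one]

theorem poissonHom_apply (x : X) (f : C(X, ℂ)) (ξ : Ell2 Γ K) (h : Γ) :
    poissonHom K x f ξ h = f (h • x) • ξ h := rfl

variable {K}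

/-- Diagonal operators commute with the Poisson transforms. -/
theorem poissonHom_mul_weightedPerm_refl (T : Γ → K →L[ℂ] K) (c : ℝ) (hT : ∀ h, ‖T h‖ ≤ c) (x : X)
    (f : C(X, ℂ)) : poissonHom K x f * weightedPerm (Equiv.refl Γ) T c hT =
      weightedPerm (Equiv.refl Γ) T c hT * poissonHom K x f := by
  ext ξ h
  rw [mul_apply_eq_comp, mul_apply_eq_comp, poissonHom_apply, weightedPerm_apply,
    weightedPerm_apply, Equiv.refl_apply, poissonHom_apply, (T h).map_smul]

variable [ContinuousConstSMul Γ X]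

theorem translates_leftTranslation (g : Γ) :
    Translates (fun x : X => poissonHom (Γ := Γ) K x) g (leftTranslation K g) := by
  intro x f
  ext ξ h
  rw [mul_apply_eq_comp, mul_apply_eq_comp, poissonHom_apply, leftTranslation_apply,
    leftTranslation_apply, poissonHom_apply, translate_apply, smul_smul, mul_inv_cancel_left]

/-- A star subalgebra `N` of operators on `ℓ²(Γ, K)` containing the left translations, together with
a unit vector `Ω` of `K`, is a covariant model, provided that the translates of `δ_e ⊗ Ω` are images
of `δ_e ⊗ Ω` under isometries from the commutant of `N`, and that the vectors obtained from `Ω` by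
diagonal operators of `N` are dense in `K`. -/
theorem isCovariantModel_of_commutant [DecidableEq Γ]
    (N : StarSubalgebra ℂ (Ell2 Γ K →L[ℂ] Ell2 Γ K))
    [IsClosed (N : Set (Ell2 Γ K →L[ℂ] Ell2 Γ K))] (hU : ∀ g, leftTranslation K g ∈ N) {Ω : K}
    (hΩ : ‖Ω‖ = 1)
    (hw : ∀ g : Γ, ∃ w : Ell2 Γ K →L[ℂ] Ell2 Γ K, star w * w = 1 ∧ (∀ m ∈ N, m * w = w * m) ∧
      w (lp.single 2 1 Ω) = lp.single 2 g Ω)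
    (hdense : ∀ g : Γ, Dense (Submodule.span ℂ {k : K | ∃ (T : Γ → K →L[ℂ] K) (c : ℝ)
      (hT : ∀ h, ‖T h‖ ≤ c), weightedPerm (Equiv.refl Γ) T c hT ∈ N ∧ T g Ω = k} : Set K)) :
    IsCovariantModel N.subtype (fun g : Γ => (⟨leftTranslation K g, hU g⟩ : N))
      (lp.single 2 1 Ω : Ell2 Γ K) (fun x : X => poissonHom (Γ := Γ) K x) where
  star_mul_self g := Subtype.ext (star_leftTranslation_mul_self g)
  norm_eq_one := by rw [lp.norm_single (by norm_num), hΩ]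
  apply_vec x f := by
    ext h
    rw [poissonHom_apply, lp.coeFn_smul, Pi.smul_apply, lp.single_apply]
    by_cases hh : h = 1
    · rw [hh, one_smul]
    · rw [Pi.single_eq_of_ne hh, smul_zero, smul_zero]
  translates g := translates_leftTranslation g
  invariant g m := by
    obtain ⟨w, hw1, hw2, hw3⟩ := hw g
    change ⟪leftTranslation K g (lp.single 2 1 Ω),
      (m : Ell2 Γ K →L[ℂ] Ell2 Γ K) (leftTranslation K g (lp.single 2 1 Ω))⟫_ℂ = _
    rw [leftTranslation_single, mul_one, ← hw3, ← mul_apply_eq_comp, hw2 m m.2, mul_apply_eq_comp,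
      ← ContinuousLinearMap.adjoint_inner_right, ← ContinuousLinearMap.star_eq_adjoint,
      ← mul_apply_eq_comp, hw1]
    rfl
  dense := by
    let S : Submodule ℂ (Ell2 Γ K) := Submodule.span ℂ {v | ∃ m : N, (∃ g : Γ,
      Translates (fun x : X => poissonHom (Γ := Γ) K x) g (N.subtype m)) ∧
        N.subtype m (lp.single 2 1 Ω) = v}
    have hsingle (g : Γ) (k : K) : lp.single 2 g k ∈ closure (S : Set (Ell2 Γ K)) := by
      let L : K →L[ℂ] Ell2 Γ K := lp.singleContinuousLinearMap ℂ (fun _ : Γ => K) 2 g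
      have hL (k) : L k = lp.single 2 g k := rfl
      have hsub : Submodule.span ℂ {k : K | ∃ (T : Γ → K →L[ℂ] K) (c : ℝ)
          (hT : ∀ h, ‖T h‖ ≤ c), weightedPerm (Equiv.refl Γ) T c hT ∈ N ∧ T g Ω = k} ≤
          S.comap (L : K →ₗ[ℂ] Ell2 Γ K) := by
        refine Submodule.span_le.mpr ?_
        rintro _ ⟨T, c, hT, hN, rfl⟩
        refine Submodule.subset_span
          ⟨⟨weightedPerm (Equiv.refl Γ) T c hT, hN⟩ * ⟨leftTranslation K g, hU g⟩, ⟨g, ?_⟩, ?_⟩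
        · intro x f
          change poissonHom K x f * (weightedPerm (Equiv.refl Γ) T c hT * leftTranslation K g) =
            weightedPerm (Equiv.refl Γ) T c hT * leftTranslation K g * _
          rw [← mul_assoc, poissonHom_mul_weightedPerm_refl, mul_assoc,
            translates_leftTranslation g x f, mul_assoc]
        · change weightedPerm (Equiv.refl Γ) T c hT (leftTranslation K g (lp.single 2 1 Ω)) = L _
          rw [leftTranslation_single, mul_one, weightedPerm_single, hL]
          rfl
      rw [← hL]
      exact closure_mono (s := L '' _) (Set.image_subset_iff.mpr hsub)
        (image_closure_subset_closure_image L.continuous ⟨k, hdense g k, rfl⟩)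
    intro v
    change v ∈ closure (S : Set (Ell2 Γ K))
    rw [← Submodule.topologicalClosure_coe]
    exact S.isClosed_topologicalClosure.mem_of_tendsto
      (lp.hasSum_single (by norm_num) v) (Eventually.of_forall fun s =>
        Submodule.sum_mem _ fun g _ => hsingle g (v g))

end Poisson

/-! ### Generated algebras -/

section VonNeumann

variable {H : Type u} [NormedAddCommGroup H] [InnerProductSpace ℂ H] [CompleteSpace H]

/-- Operators that commute with a set and its adjoints commute with the von Neumann algebra that it
generates. -/
theorem mul_eq_mul_of_mem_vnGen {S : Set (H →L[ℂ] H)} {w : H →L[ℂ] H}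
    (h1 : ∀ s ∈ S, s * w = w * s) (h2 : ∀ s ∈ S, star s * w = w * star s) {m : H →L[ℂ] H}
    (hm : m ∈ (vnGen S).toStarSubalgebra) : m * w = w * m := by
  have hw : w ∈ StarSubalgebra.centralizer ℂ S :=
    (StarSubalgebra.mem_centralizer_iff ℂ).mpr fun s hs => ⟨h1 s hs, h2 s hs⟩
  exact (((StarSubalgebra.mem_centralizer_iff ℂ).mp hm) w hw).1.symm

end VonNeumann

section Generated

theorem subtype_image_adjoin_preimage {E : Type*} [CStarAlgebra E] (B : StarSubalgebra ℂ E)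
    {S : Set E} (hS : S ⊆ B) :
    ((↑) '' (StarAlgebra.adjoin ℂ ((↑) ⁻¹' S : Set B) : Set B) : Set E) =
      StarAlgebra.adjoin ℂ S := by
  have h := StarAlgHom.map_adjoin B.subtype ((↑) ⁻¹' S : Set B)
  have himage : B.subtype '' ((↑) ⁻¹' S : Set B) = S :=
    (Subtype.image_preimage_coe (B : Set E) S).trans (Set.inter_eq_self_of_subset_right hS)
  rw [himage] at h
  exact congrArg SetLike.coe h

/-- If a subalgebra `B` is generated by `S`, then `S` generates `B` also inside `B`. -/
theorem adjoin_preimage_topologicalClosure {E : Type*} [CStarAlgebra E] (B : StarSubalgebra ℂ E)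
    {S : Set E} (hB : B = (StarAlgebra.adjoin ℂ S).topologicalClosure) :
    (StarAlgebra.adjoin ℂ ((↑) ⁻¹' S : Set B)).topologicalClosure = ⊤ := by
  have hS : S ⊆ B := by
    rw [hB]
    exact (StarAlgebra.subset_adjoin ℂ S).trans (StarSubalgebra.le_topologicalClosure _)
  have hle : (B : Set E) ⊆ closure (StarAlgebra.adjoin ℂ S : Set E) := by
    conv_lhs => rw [hB]
    rw [StarSubalgebra.topologicalClosure_coe]
  refine eq_top_iff.mpr fun b _ => ?_
  rw [← SetLike.mem_coe, StarSubalgebra.topologicalClosure_coe, closure_subtype,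
    subtype_image_adjoin_preimage B hS]
  exact hle b.2

variable {H : Type u} [NormedAddCommGroup H] [InnerProductSpace ℂ H] [CompleteSpace H]
  {X : Type w} [TopologicalSpace X]

theorem isGeneratedBy_of_eq (N B : StarSubalgebra ℂ (H →L[ℂ] H))
    [IsClosed (N : Set (H →L[ℂ] H))] [IsClosed (B : Set (H →L[ℂ] H))]
    (θ : C(X, ℂ) →⋆ₐ[ℂ] (H →L[ℂ] H)) (hB : B = cstarGen (N ∪ Set.range θ))
    (hN : N ≤ B) (hθ : ∀ f, θ f ∈ B) :
    IsGeneratedBy N.subtype θ B.subtype (StarSubalgebra.inclusion hN) (θ.codRestrict B hθ) where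
  injective := Subtype.val_injective
  apply_incl _ := rfl
  apply_func _ := rfl
  closure_eq_top := by
    have h : Set.range (StarSubalgebra.inclusion hN) ∪ Set.range (θ.codRestrict B hθ) =
        ((↑) ⁻¹' ((N : Set (H →L[ℂ] H)) ∪ Set.range θ) : Set B) := by
      ext b
      constructor
      · rintro (⟨m, rfl⟩ | ⟨f, rfl⟩)
        · exact Or.inl m.2
        · exact Or.inr ⟨f, rfl⟩
      · rintro (hb | ⟨f, hf⟩)
        · exact Or.inl ⟨⟨b, hb⟩, rfl⟩
        · exact Or.inr ⟨f, Subtype.ext hf⟩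
    rw [h]
    exact adjoin_preimage_topologicalClosure B hB

end Generated

/-! ### The crossed product and the group von Neumann algebra -/

section CrossedProduct

variable {A : Type v} [CStarAlgebra A] [PartialOrder A] [StarOrderedRing A] {τ : A →ₚ[ℂ] ℂ}

/-- A trace preserving automorphism is implemented by an isometry of `L²(A, τ)`. -/
theorem exists_gns_isometry (α : A ≃⋆ₐ[ℂ] A) (hα : ∀ a, τ (α a) = τ a) :
    ∃ V : τ.GNS →L[ℂ] τ.GNS, star V * V = 1 ∧ (∀ a, V (gnsVec τ a) = gnsVec τ (α a)) ∧
      ∀ a, V * τ.gnsStarAlgHom a = τ.gnsStarAlgHom (α a) * V := by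
  obtain ⟨V, hVV, hV⟩ := exists_isometry_of_inner_eq (denseRange_gnsVec (τ := τ))
    (gnsVec τ ∘ₗ ((α : A →⋆ₐ[ℂ] A) : A →ₗ[ℂ] A)) fun a b => by
      change ⟪gnsVec τ (α a), gnsVec τ (α b)⟫_ℂ = _
      rw [inner_gnsVec, inner_gnsVec, ← map_star, ← map_mul, hα]
  replace hV (a : A) : V (gnsVec τ a) = gnsVec τ (α a) := hV a
  refine ⟨V, hVV, hV, fun a => ?_⟩
  refine ContinuousLinearMap.ext fun η => ?_
  refine denseRange_gnsVec.induction_on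
    (p := fun η => (V * τ.gnsStarAlgHom a) η = (τ.gnsStarAlgHom (α a) * V) η) η
    (isClosed_eq (by fun_prop) (by fun_prop)) (fun b => ?_)
  rw [mul_apply_eq_comp, mul_apply_eq_comp, gnsStarAlgHom_gnsVec, hV, hV, gnsStarAlgHom_gnsVec,
    map_mul]

variable {Γ : Type u} [Group Γ] (σ : Γ →* (A ≃⋆ₐ[ℂ] A))

theorem star_crossedRep (a : A) : star (crossedRep τ σ a) = crossedRep τ σ (star a) := by
  rw [crossedRep, crossedRep, star_weightedPerm]
  refine weightedPerm_congr (fun _ => rfl) (fun h => ?_)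
  rw [map_star, map_star]
  rfl

variable {X : Type w} [TopologicalSpace X] [CompactSpace X] [MulAction Γ X]

/-- The crossed product `Γ ⋉ A` with the vector `δ_e ⊗ 1` is a covariant model. The right
translations twisted by the implementation of the action lie in its commutant. -/
theorem isCovariantModel_crossedProduct [ContinuousConstSMul Γ X] [DecidableEq Γ] (hτ : τ 1 = 1)
    (hσ : ∀ (g : Γ) (a : A), τ (σ g a) = τ a) :
    IsCovariantModel (crossedProduct τ σ).toStarSubalgebra.subtype
      (fun g : Γ => (⟨leftTranslation τ.GNS g, subset_vnGen _ (Or.inl ⟨g, rfl⟩)⟩ :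
        (crossedProduct τ σ).toStarSubalgebra))
      (lp.single 2 1 (gnsVec τ 1) : Ell2 Γ τ.GNS)
      (fun x : X => poissonHom (Γ := Γ) τ.GNS x) := by
  refine isCovariantModel_of_commutant _ (fun g => subset_vnGen _ (Or.inl ⟨g, rfl⟩)) ?_
    (fun g => ?_) fun g => ?_
  · rw [@norm_eq_sqrt_re_inner ℂ, inner_gnsVec, star_one, one_mul, hτ]
    simp
  · obtain ⟨V, hV1, hV2, hV3⟩ := exists_gns_isometry (σ g⁻¹) (hσ g⁻¹)
    have hw1 : star (weightedPerm (Equiv.mulRight g⁻¹) (fun _ => V) ‖V‖ fun _ => le_rfl) *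
        (weightedPerm (Equiv.mulRight g⁻¹) (fun _ => V) ‖V‖ fun _ => le_rfl) = 1 := by
      rw [star_weightedPerm]
      ext ξ h
      rw [mul_apply_eq_comp, weightedPerm_apply, weightedPerm_apply, ← mul_apply_eq_comp, hV1,
        Equiv.apply_symm_apply]
      rfl
    have hgen : ∀ s ∈ crossedGenerators τ σ,
        s * (weightedPerm (Equiv.mulRight g⁻¹) (fun _ => V) ‖V‖ fun _ => le_rfl) =
        (weightedPerm (Equiv.mulRight g⁻¹) (fun _ => V) ‖V‖ fun _ => le_rfl) * s := by
      rintro _ (⟨s, rfl⟩ | ⟨a, rfl⟩)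
      · ext ξ h
        rw [mul_apply_eq_comp, mul_apply_eq_comp, leftTranslation_apply, weightedPerm_apply,
          weightedPerm_apply, leftTranslation_apply]
        exact congrArg (fun k => V (ξ k)) (mul_assoc s⁻¹ h g⁻¹)
      · ext ξ h
        have hσa : σ g⁻¹ ((σ (h * g⁻¹))⁻¹ a) = (σ h)⁻¹ a := by
          rw [← map_inv, ← map_inv, ← StarAlgEquiv.mul_apply, ← map_mul]
          congr 2
          group
        have hv := congrArg (fun T => T (ξ (h * g⁻¹))) (hV3 ((σ (h * g⁻¹))⁻¹ a))
        rw [hσa] at hv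
        exact hv.symm
    refine ⟨weightedPerm (Equiv.mulRight g⁻¹) (fun _ => V) ‖V‖ fun _ => le_rfl, hw1, fun m hm =>
      mul_eq_mul_of_mem_vnGen hgen (fun s hs => hgen _ ?_) hm, ?_⟩
    · rcases hs with ⟨s, rfl⟩ | ⟨a, rfl⟩
      · exact Or.inl ⟨s⁻¹, (star_leftTranslation s).symm⟩
      · exact Or.inr ⟨star a, (star_crossedRep σ a).symm⟩
    -- `V` fixes the vector of `1`.
    · rw [weightedPerm_single, hV2, map_one (σ g⁻¹)]
      exact congrArg (fun k => lp.single 2 k (gnsVec τ 1)) (by simp)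
  -- `π(σ_g(a))` acts as `a` on the fibre over `g`.
  · refine denseRange_gnsVec.mono ?_
    rintro _ ⟨a, rfl⟩
    refine Submodule.subset_span ⟨_, _, _, subset_vnGen _ (Or.inr ⟨σ g a, rfl⟩), ?_⟩
    rw [gnsStarAlgHom_gnsVec, mul_one]
    exact congrArg _ ((σ g).symm_apply_apply a)

/-- The group von Neumann algebra with the vector `δ_e` is a covariant model. The right
translations lie in its commutant. -/
theorem isCovariantModel_groupVN (Γ : Type u) [Group Γ] [MulAction Γ X] [ContinuousConstSMul Γ X]
    [DecidableEq Γ] :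
    IsCovariantModel (groupVN Γ).toStarSubalgebra.subtype
      (fun g : Γ => (⟨leftTranslation ℂ g, subset_vnGen _ (Set.mem_range_self g)⟩ :
        (groupVN Γ).toStarSubalgebra))
      (lp.single 2 1 (1 : ℂ) : Ell2 Γ ℂ)
      (fun x : X => poissonHom (Γ := Γ) ℂ x) := by
  refine isCovariantModel_of_commutant _ (fun g => subset_vnGen _ (Set.mem_range_self g)) norm_one
    (fun g => ?_) fun g => ?_
  · have hw1 : star (weightedPerm (Equiv.mulRight g⁻¹) (fun _ => (1 : ℂ →L[ℂ] ℂ)) 1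
          fun _ => norm_one.le) *
        (weightedPerm (Equiv.mulRight g⁻¹) (fun _ => (1 : ℂ →L[ℂ] ℂ)) 1
          fun _ => norm_one.le) = 1 := by
      rw [star_weightedPerm]
      ext ξ h
      rw [mul_apply_eq_comp, weightedPerm_apply, weightedPerm_apply, ← mul_apply_eq_comp, star_one,
        one_mul, Equiv.apply_symm_apply]
      rfl
    have hgen (s : Γ) : leftTranslation ℂ s *
        (weightedPerm (Equiv.mulRight g⁻¹) (fun _ => (1 : ℂ →L[ℂ] ℂ)) 1 fun _ => norm_one.le) =
        (weightedPerm (Equiv.mulRight g⁻¹) (fun _ => (1 : ℂ →L[ℂ] ℂ)) 1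
          fun _ => norm_one.le) * leftTranslation ℂ s := by
      ext ξ h
      rw [mul_apply_eq_comp, mul_apply_eq_comp, leftTranslation_apply, weightedPerm_apply,
        weightedPerm_apply, leftTranslation_apply]
      exact congrArg (fun k => ξ k) (mul_assoc s⁻¹ h g⁻¹)
    refine ⟨weightedPerm (Equiv.mulRight g⁻¹) (fun _ => (1 : ℂ →L[ℂ] ℂ)) 1 fun _ => norm_one.le,
      hw1, fun m hm => mul_eq_mul_of_mem_vnGen ?_ ?_ hm, ?_⟩
    · rintro _ ⟨s, rfl⟩
      exact hgen s
    · rintro _ ⟨s, rfl⟩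
      rw [star_leftTranslation]
      exact hgen s⁻¹
    · rw [weightedPerm_single]
      congr 1
      simp
  -- The fibres are one-dimensional, so the identity operator suffices.
  · have h1 : (1 : Ell2 Γ ℂ →L[ℂ] Ell2 Γ ℂ) = weightedPerm (Equiv.refl Γ)
        (fun _ => (1 : ℂ →L[ℂ] ℂ)) 1 fun _ => norm_one.le := rfl
    have hone : (1 : ℂ) ∈ Submodule.span ℂ {k : ℂ | ∃ (T : Γ → ℂ →L[ℂ] ℂ) (c : ℝ)
        (hT : ∀ h, ‖T h‖ ≤ c), weightedPerm (Equiv.refl Γ) T c hT ∈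
          (groupVN Γ).toStarSubalgebra ∧ T g 1 = k} :=
      Submodule.subset_span ⟨fun _ => 1, 1, fun _ => norm_one.le,
        h1 ▸ one_mem (groupVN Γ).toStarSubalgebra, rfl⟩
    intro z
    refine subset_closure ?_
    have := Submodule.smul_mem _ z hone
    rwa [smul_eq_mul, mul_one] at this

theorem crossedToAmbient_injective : Function.Injective (crossedToAmbient τ σ) :=
  StarSubalgebra.inclusion_injective _

theorem isGeneratedBy_boundaryAlg (x : X) :
    IsGeneratedBy (crossedProduct τ σ).toStarSubalgebra.subtype (poissonHom (Γ := Γ) τ.GNS x)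
      (boundaryAlg τ σ x).subtype (crossedToBoundary τ σ x)
      ((poissonHom τ.GNS x).codRestrict (boundaryAlg τ σ x)
        fun f => subset_cstarGen _ (Or.inr ⟨f, rfl⟩)) :=
  isGeneratedBy_of_eq _ _ _ rfl _ _

theorem isGeneratedBy_groupBoundaryAlg (Γ : Type u) [Group Γ] [MulAction Γ X] (x : X) :
    IsGeneratedBy (groupVN Γ).toStarSubalgebra.subtype (poissonHom (Γ := Γ) ℂ x)
      (groupBoundaryAlg Γ x).subtype (groupToBoundary Γ x)
      ((poissonHom ℂ x).codRestrict (groupBoundaryAlg Γ x)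
        fun f => subset_cstarGen _ (Or.inr ⟨f, rfl⟩)) :=
  isGeneratedBy_of_eq _ _ _ rfl _ _

end CrossedProduct

end NCBoundary

end

theorem theorem6 {Γ : Type u} [Group Γ] [Countable Γ]
    {A : Type v} [CStarAlgebra A] [WStarAlgebra A] [PartialOrder A] [StarOrderedRing A]
    (τ : A →ₚ[ℂ] ℂ) (hτ : NCBoundary.IsNormalFaithfulTrace τ)
    [TopologicalSpace.SeparableSpace τ.GNS]
    (σ : Γ →* (A ≃⋆ₐ[ℂ] A)) (hσ : ∀ (g : Γ) (a : A), τ (σ g a) = τ a)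
    {X : Type w} [TopologicalSpace X] [CompactSpace X] [T2Space X]
    [MeasurableSpace X] [BorelSpace X] [MulAction Γ X] [ContinuousConstSMul Γ X]
    (hX : NCBoundary.IsTopologicalBoundary Γ X) (x : X) :
    (∀ P : NCBoundary.boundaryAlg τ σ x →CP (NCBoundary.ambient τ σ).toStarSubalgebra,
      NCBoundary.IsBimodularUCP (NCBoundary.crossedToBoundary τ σ x)
        (NCBoundary.crossedToAmbient τ σ) P → NCBoundary.IsCompletelyIsometric P) ∧
    (∀ y : X, ∃ Φ : NCBoundary.boundaryAlg τ σ x ≃⋆ₐ[ℂ] NCBoundary.boundaryAlg τ σ y,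
      ∀ (m n : (NCBoundary.crossedProduct τ σ).toStarSubalgebra)
        (b : NCBoundary.boundaryAlg τ σ x),
        Φ (NCBoundary.crossedToBoundary τ σ x m * b * NCBoundary.crossedToBoundary τ σ x n) =
          NCBoundary.crossedToBoundary τ σ y m * Φ b * NCBoundary.crossedToBoundary τ σ y n) ∧
    (NCBoundary.IsAmenableVN (NCBoundary.standardVN τ) →
      NCBoundary.IsEssential.{max u v, max u v, z} (NCBoundary.crossedToBoundary τ σ x)) ∧
    NCBoundary.IsEssential.{u, u, z} (NCBoundary.groupToBoundary Γ x) := by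
  classical
  have hmodel := NCBoundary.isCovariantModel_crossedProduct (X := X) σ hτ.map_one hσ
  refine ⟨?_, fun y => ?_, fun _ => ?_, ?_⟩
  · have hess := hmodel.isEssential Subtype.val_injective
      (NCBoundary.isGeneratedBy_boundaryAlg σ x) hX
    exact hess.2 _ _ (NCBoundary.crossedToAmbient_injective σ)
  · obtain ⟨Φ, hΦ⟩ := hmodel.exists_starAlgEquiv hX (NCBoundary.isGeneratedBy_boundaryAlg σ x)
      (NCBoundary.isGeneratedBy_boundaryAlg σ y)
    refine ⟨Φ, fun m n b => ?_⟩
    exact NCBoundary.apply_mul_mul_of_apply_eq Φ hΦ m n b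
  · exact hmodel.isEssential Subtype.val_injective (NCBoundary.isGeneratedBy_boundaryAlg σ x) hX
  · exact (NCBoundary.isCovariantModel_groupVN (X := X) Γ).isEssential Subtype.val_injective
      (NCBoundary.isGeneratedBy_groupBoundaryAlg Γ x) hX
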